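/- Let $M$ be a compact smooth manifold, possibly with boundary, and let $(\mathcal Q,\Delta)$ be a compact quantum group: a unital $C^*$-algebra $\mathcal Q$ with a coassociative unital $*$-homomorphism $\Delta:\mathcal Q\to\mathcal Q\hat\otimes\mathcal Q$ (minimal tensor product) such that the linear spans of $\Delta(\mathcal Q)(\mathcal Q\otimes 1)$ and $\Delta(\mathcal Q)(1\otimes\mathcal Q)$ are norm dense in $\mathcal Q\hat\otimes\mathcal Q$. Let $C^\infty(M)$ be the Fréchet $*$-algebra of complex smooth functions on $M$, identify $C^\infty(M)\hat\otimes\mathcal Q$ with the Fréchet $*$-algebra $C^\infty(M,\mathcal Q)$ of smooth $\mathcal Q$-valued functions, let $\Omega^1(C^\infty(M))$ be the Fréchet space of complex smooth one-forms and identify $\Omega^1(C^\infty(M))\bar\otimes\mathcal Q$ with the Fréchet space of smooth $\mathcal Q$-valued one-forms; it is a bimodule over $C^\infty(M,\mathcal Q)$ by pointwise multiplication from the left and from the right. Write $d\otimes\mathrm{id}$ and $\nu\otimes\mathrm{id}$ for the exterior derivative of $\mathcal Q$-valued functions and for their derivative along a vector field $\nu$. Let $\alpha:C^\infty(M)\to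 C^\infty(M,\mathcal Q)$ be a smooth action of $\mathcal Q$ on $M$, that is, a Fréchet continuous unital $*$-homomorphism such that $(\alpha\otimes\mathrm{id})\alpha=(\mathrm{id}\otimes\Delta)\alpha$, such that the linear span of $\alpha(C^\infty(M))(1\otimes\mathcal Q)$ is Fréchet dense in $C^\infty(M,\mathcal Q)$, and such that, if $M$ has a boundary, $\alpha(f)$ vanishes on $\partial M$ whenever $f\in C^\infty(M)$ does. **Theorem.** The following are equivalent: (i) There is a Fréchet continuous linear map $\beta:\Omega^1(C^\infty(M))\to\Omega^1(C^\infty(M))\bar\otimes\mathcal Q$ with $$\beta(f\omega)=\alpha(f)\beta(\omega),\qquad \beta(\omega f)=\beta(\omega)\alpha(f),\qquad \beta(df)=(d\otimes\mathrm{id})(\alpha(f))$$ for all $f\in C^\infty(M)$ and $\omega\in\Omega^1(C^\infty(M))$. (ii) For all $f,g\in C^\infty(M)$ and all smooth vector fields $\nu$ on $M$, $$\big((\nu\otimes\mathrm{id})\alpha(f)\big)\,\alpha(g)=\alpha(g)\,\big((\nu\otimes\mathrm{id})\alpha(f)\big).$$ -/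

import Mathlib

open scoped TensorProduct ContDiff Manifold Topology

universe u v

noncomputable section

/-! ## The minimal (spatial) tensor product of unital C*-algebras -/

/-- A unital `*`-representation of a unital C*-algebra on a Hilbert space. -/
structure HilbertRep (A : Type u) [CStarAlgebra A] where
  space : Type u
  [normed : NormedAddCommGroup space]
  [inner : InnerProductSpace ℂ space]
  [complete : CompleteSpace space]
  toHom : A →⋆ₐ[ℂ] (space →L[ℂ] space)

attribute [instance] HilbertRep.normed HilbertRep.inner HilbertRep.complete

theorem HilbertRep.norm_le {A : Type u} [CStarAlgebra A] (π : HilbertRep A) (a : A) :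
    ‖π.toHom a‖ ≤ ‖a‖ :=
  NonUnitalStarAlgHom.norm_apply_le π.toHom a

/-- Pull back a representation along a unital `*`-homomorphism. -/
def HilbertRep.comp {A B : Type u} [CStarAlgebra A] [CStarAlgebra B] (π : HilbertRep B)
    (φ : A →⋆ₐ[ℂ] B) : HilbertRep A where
  space := π.space
  toHom := π.toHom.comp φ

/-- The trivial representation on the zero space. -/
def HilbertRep.zero (A : Type u) [CStarAlgebra A] : HilbertRep A where
  space := PUnit
  toHom :=
    { toFun := fun _ => 0
      map_one' := Subsingleton.elim _ _
      map_mul' := fun _ _ => Subsingleton.elim _ _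
      map_zero' := rfl
      map_add' := fun _ _ => Subsingleton.elim _ _
      commutes' := fun _ => Subsingleton.elim _ _
      map_star' := fun _ => Subsingleton.elim _ _ }

/-- The algebraic tensor product of two C*-algebras, as a type of its own, so that it can carry
the spatial norm. -/
def AlgTensor (A B : Type u) [CStarAlgebra A] [CStarAlgebra B] : Type u := A ⊗[ℂ] B

namespace AlgTensor

variable {A B C D : Type u} [CStarAlgebra A] [CStarAlgebra B] [CStarAlgebra C] [CStarAlgebra D]

instance : Ring (AlgTensor A B) := inferInstanceAs (Ring (A ⊗[ℂ] B))
instance : Algebra ℂ (AlgTensor A B) := inferInstanceAs (Algebra ℂ (A ⊗[ℂ] B))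
instance : StarRing (AlgTensor A B) := inferInstanceAs (StarRing (A ⊗[ℂ] B))
instance : StarModule ℂ (AlgTensor A B) := inferInstanceAs (StarModule ℂ (A ⊗[ℂ] B))

/-- The elementary tensor `a ⊗ b`. -/
def tmul (a : A) (b : B) : AlgTensor A B := a ⊗ₜ[ℂ] b

theorem induction {p : AlgTensor A B → Prop} (x : AlgTensor A B) (h0 : p 0)
    (h1 : ∀ a b, p (tmul a b)) (h2 : ∀ x y, p x → p y → p (x + y)) : p x :=
  TensorProduct.induction_on x h0 h1 h2

/-- The (algebraic, pre-Hilbert) tensor product `H ⊗ K` of the spaces of two representations, with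
`⟪h ⊗ k, h' ⊗ k'⟫ = ⟪h, h'⟫ ⟪k, k'⟫`. -/
def RepSpace (π : HilbertRep A) (σ : HilbertRep B) : Type u := π.space ⊗[ℂ] σ.space

instance (π : HilbertRep A) (σ : HilbertRep B) : NormedAddCommGroup (RepSpace π σ) :=
  inferInstanceAs (NormedAddCommGroup (π.space ⊗[ℂ] σ.space))
instance (π : HilbertRep A) (σ : HilbertRep B) : InnerProductSpace ℂ (RepSpace π σ) :=
  inferInstanceAs (InnerProductSpace ℂ (π.space ⊗[ℂ] σ.space))

/-- The bounded operator `π(a) ⊗ σ(b)` on `H ⊗ K`. -/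
def repOp (π : HilbertRep A) (σ : HilbertRep B) (a : A) (b : B) :
    RepSpace π σ →L[ℂ] RepSpace π σ :=
  TensorProduct.mapL (π.toHom a) (σ.toHom b)

/-- For representations `π` of `A` on `H` and `σ` of `B` on `K`, the representation `π ⊗ σ` of the
algebraic tensor product `A ⊗ B` by bounded operators on the (algebraic, pre-Hilbert) tensor
product `H ⊗ K`, with `(π ⊗ σ)(a ⊗ b) = π(a) ⊗ σ(b)`. -/
def rep (π : HilbertRep A) (σ : HilbertRep B) :
    AlgTensor A B →ₐ[ℂ] (RepSpace π σ →L[ℂ] RepSpace π σ) :=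
  Algebra.TensorProduct.algHomOfLinearMapTensorProduct
    (TensorProduct.lift (LinearMap.mk₂ ℂ (repOp π σ)
      (fun a a' b => (congrArg (TensorProduct.mapL · (σ.toHom b)) (map_add π.toHom a a')).trans
        (TensorProduct.mapL_add_left _ _ _))
      (fun c a b => (congrArg (TensorProduct.mapL · (σ.toHom b)) (map_smul π.toHom c a)).trans
        (TensorProduct.mapL_smul_left _ _ _))
      (fun a b b' => (congrArg (TensorProduct.mapL (π.toHom a)) (map_add σ.toHom b b')).trans
        (TensorProduct.mapL_add_right _ _ _))
      (fun c a b => (congrArg (TensorProduct.mapL (π.toHom a)) (map_smul σ.toHom c b)).trans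
        (TensorProduct.mapL_smul_right _ _ _))))
    (fun a₁ a₂ b₁ b₂ => (congrArg₂ TensorProduct.mapL (map_mul π.toHom a₁ a₂)
      (map_mul σ.toHom b₁ b₂)).trans (TensorProduct.mapL_mul _ _ _ _))
    ((congrArg₂ TensorProduct.mapL (map_one π.toHom) (map_one σ.toHom)).trans
      TensorProduct.mapL_id_id)

theorem rep_tmul (π : HilbertRep A) (σ : HilbertRep B) (a : A) (b : B) :
    rep π σ (tmul a b) = repOp π σ a b := rfl

theorem inner_mapL (π : HilbertRep A) (σ : HilbertRep B) (a : A) (b : B)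
    (u v : π.space ⊗[ℂ] σ.space) :
    inner ℂ (TensorProduct.mapL (π.toHom a) (σ.toHom b) u) v =
      inner ℂ u (TensorProduct.mapL (π.toHom (star a)) (σ.toHom (star b)) v) := by
  induction u using TensorProduct.induction_on with
  | zero => simp
  | add x y hx hy => rw [map_add, inner_add_left, inner_add_left, hx, hy]
  | tmul h k =>
    induction v using TensorProduct.induction_on with
    | zero => simp
    | add x y hx hy => rw [map_add, inner_add_right, inner_add_right, hx, hy]
    | tmul h' k' =>
      simp only [TensorProduct.mapL_tmul, TensorProduct.inner_tmul, map_star,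
        ContinuousLinearMap.star_eq_adjoint, ContinuousLinearMap.adjoint_inner_right]

theorem inner_rep (π : HilbertRep A) (σ : HilbertRep B) (x : AlgTensor A B)
    (u v : RepSpace π σ) :
    inner ℂ (rep π σ x u) v = inner ℂ u (rep π σ (star x) v) := by
  induction x using AlgTensor.induction with
  | h0 => simp
  | h1 a b =>
    have : star (tmul a b) = tmul (star a) (star b) := TensorProduct.star_tmul a b
    rw [this, rep_tmul, rep_tmul]
    exact inner_mapL π σ a b u v
  | h2 x y hx hy =>
    rw [star_add, map_add, map_add, _root_.add_apply, _root_.add_apply,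
      inner_add_left, inner_add_right, hx, hy]

theorem norm_rep_sq_le (π : HilbertRep A) (σ : HilbertRep B) (x : AlgTensor A B) :
    ‖rep π σ x‖ * ‖rep π σ x‖ ≤ ‖rep π σ (star x * x)‖ := by
  have key : ‖rep π σ x‖ ≤ Real.sqrt ‖rep π σ (star x * x)‖ := by
    refine ContinuousLinearMap.opNorm_le_bound _ (Real.sqrt_nonneg _) fun u => ?_
    have h1 : ‖rep π σ x u‖ ^ 2 ≤ ‖rep π σ (star x * x)‖ * ‖u‖ ^ 2 := by
      have h2 : inner ℂ (rep π σ x u) (rep π σ x u) = inner ℂ u (rep π σ (star x * x) u) := by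
        rw [inner_rep, map_mul, mul_apply_eq_comp]
      have h3 : ‖rep π σ x u‖ ^ 2 = ‖(inner ℂ (rep π σ x u) (rep π σ x u) : ℂ)‖ := by
        rw [inner_self_eq_norm_sq_to_K]; simp
      rw [h3, h2]
      calc _ ≤ ‖u‖ * ‖rep π σ (star x * x) u‖ := norm_inner_le_norm _ _
        _ ≤ ‖u‖ * (‖rep π σ (star x * x)‖ * ‖u‖) := by
            gcongr; exact ContinuousLinearMap.le_opNorm _ _
        _ = _ := by ring
    calc ‖rep π σ x u‖ = Real.sqrt (‖rep π σ x u‖ ^ 2) := (Real.sqrt_sq (norm_nonneg _)).symm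
      _ ≤ Real.sqrt (‖rep π σ (star x * x)‖ * ‖u‖ ^ 2) := Real.sqrt_le_sqrt h1
      _ = _ := by rw [Real.sqrt_mul (norm_nonneg _), Real.sqrt_sq (norm_nonneg _)]
  calc _ ≤ Real.sqrt ‖rep π σ (star x * x)‖ * Real.sqrt ‖rep π σ (star x * x)‖ := by gcongr
    _ = _ := Real.mul_self_sqrt (norm_nonneg _)

theorem norm_rep_tmul_le (π : HilbertRep A) (σ : HilbertRep B) (a : A) (b : B) :
    ‖rep π σ (tmul a b)‖ ≤ ‖a‖ * ‖b‖ := by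
  refine (TensorProduct.norm_mapL_le _ _).trans ?_
  gcongr
  · exact π.norm_le a
  · exact σ.norm_le b

theorem exists_bound (x : AlgTensor A B) :
    ∃ C : ℝ, ∀ r : HilbertRep A × HilbertRep B, ‖rep r.1 r.2 x‖ ≤ C := by
  induction x using AlgTensor.induction with
  | h0 => exact ⟨0, fun r => by simp⟩
  | h1 a b => exact ⟨_, fun r => norm_rep_tmul_le r.1 r.2 a b⟩
  | h2 x y hx hy =>
    obtain ⟨C, hC⟩ := hx
    obtain ⟨D, hD⟩ := hy
    exact ⟨C + D, fun r => by
      rw [map_add]; exact (norm_add_le _ _).trans (add_le_add (hC r) (hD r))⟩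

/-- The minimal (spatial) norm `‖x‖ = sup ‖(π ⊗ σ)(x)‖` over all pairs of representations. -/
instance : Norm (AlgTensor A B) where
  norm x := ⨆ r : HilbertRep A × HilbertRep B, ‖rep r.1 r.2 x‖

instance : Nonempty (HilbertRep A × HilbertRep B) := ⟨(HilbertRep.zero A, HilbertRep.zero B)⟩

theorem norm_def (x : AlgTensor A B) :
    ‖x‖ = ⨆ r : HilbertRep A × HilbertRep B, ‖rep r.1 r.2 x‖ := rfl

theorem norm_rep_le (π : HilbertRep A) (σ : HilbertRep B) (x : AlgTensor A B) :
    ‖rep π σ x‖ ≤ ‖x‖ := by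
  obtain ⟨C, hC⟩ := exists_bound x
  exact le_ciSup (f := fun r : HilbertRep A × HilbertRep B => ‖rep r.1 r.2 x‖)
    ⟨C, by rintro _ ⟨r, rfl⟩; exact hC r⟩ (π, σ)

theorem norm_le_of {x : AlgTensor A B} {c : ℝ}
    (h : ∀ (π : HilbertRep A) (σ : HilbertRep B), ‖rep π σ x‖ ≤ c) : ‖x‖ ≤ c :=
  ciSup_le fun r => h r.1 r.2

theorem norm_nonneg' (x : AlgTensor A B) : 0 ≤ ‖x‖ :=
  (norm_nonneg _).trans (norm_rep_le (HilbertRep.zero A) (HilbertRep.zero B) x)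

instance : SeminormedAddCommGroup (AlgTensor A B) :=
  SeminormedAddCommGroup.ofCore (𝕜 := ℂ)
    { norm_nonneg := norm_nonneg'
      norm_smul := fun c x => by
        have hle : ∀ (c : ℂ) (x : AlgTensor A B), ‖c • x‖ ≤ ‖c‖ * ‖x‖ := fun c x =>
          norm_le_of fun π σ => by
            rw [map_smul, norm_smul]
            gcongr
            exact norm_rep_le π σ x
        refine le_antisymm (hle c x) ?_
        by_cases hc : c = 0
        · simpa [hc] using norm_nonneg' (c • x)
        · have h := hle c⁻¹ (c • x)
          rw [inv_smul_smul₀ hc, norm_inv] at h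
          have hc' : 0 < ‖c‖ := norm_pos_iff.mpr hc
          calc ‖c‖ * ‖x‖ ≤ ‖c‖ * (‖c‖⁻¹ * ‖c • x‖) := by gcongr
            _ = ‖c • x‖ := by field_simp
      norm_triangle := fun x y => norm_le_of fun π σ => by
        rw [map_add]
        exact (norm_add_le _ _).trans (add_le_add (norm_rep_le π σ x) (norm_rep_le π σ y)) }

instance : SeminormedRing (AlgTensor A B) where
  __ := (inferInstance : Ring (AlgTensor A B))
  __ := (inferInstance : SeminormedAddCommGroup (AlgTensor A B))
  norm_mul_le x y := norm_le_of fun π σ => by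
    rw [map_mul]
    exact (norm_mul_le _ _).trans
      (mul_le_mul (norm_rep_le π σ x) (norm_rep_le π σ y) (norm_nonneg _) (norm_nonneg' x))

instance : NormedAlgebra ℂ (AlgTensor A B) where
  norm_smul_le c x := norm_le_of fun π σ => by
    rw [map_smul, norm_smul]
    gcongr
    exact norm_rep_le π σ x

theorem norm_tmul_le (a : A) (b : B) : ‖tmul a b‖ ≤ ‖a‖ * ‖b‖ :=
  norm_le_of fun π σ => norm_rep_tmul_le π σ a b

theorem norm_mul_self_le (x : AlgTensor A B) : ‖x‖ * ‖x‖ ≤ ‖star x * x‖ := by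
  have h : ‖x‖ ≤ Real.sqrt ‖star x * x‖ := norm_le_of fun π σ =>
    Real.le_sqrt_of_sq_le (by
      rw [pow_two]
      exact (norm_rep_sq_le π σ x).trans (norm_rep_le π σ _))
  calc _ ≤ Real.sqrt ‖star x * x‖ * Real.sqrt ‖star x * x‖ := by gcongr
    _ = _ := Real.mul_self_sqrt (norm_nonneg _)

theorem norm_star_le (x : AlgTensor A B) : ‖star x‖ ≤ ‖x‖ := by
  have h := norm_mul_self_le (star x)
  rw [star_star] at h
  have h' := h.trans (norm_mul_le x (star x))
  by_contra hlt
  push Not at hlt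
  nlinarith [norm_nonneg x, norm_nonneg (star x)]

/-- The algebraic tensor product `φ ⊗ ψ` of two unital `*`-homomorphisms, a contraction for the
spatial norms. -/
def map (φ : A →⋆ₐ[ℂ] C) (ψ : B →⋆ₐ[ℂ] D) : AlgTensor A B →L[ℂ] AlgTensor C D :=
  LinearMap.mkContinuous
    (TensorProduct.map φ.toAlgHom.toLinearMap ψ.toAlgHom.toLinearMap :
      A ⊗[ℂ] B →ₗ[ℂ] C ⊗[ℂ] D) 1 fun x => by
    rw [one_mul]
    refine norm_le_of fun π σ => ?_
    have h : ∀ y : AlgTensor A B, rep π σ ((TensorProduct.map φ.toAlgHom.toLinearMap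
        ψ.toAlgHom.toLinearMap : A ⊗[ℂ] B →ₗ[ℂ] C ⊗[ℂ] D) y) =
        rep (π.comp φ) (σ.comp ψ) y := fun y => by
      induction y using AlgTensor.induction with
      | h0 => exact (map_zero (rep π σ)).trans (map_zero (rep (π.comp φ) (σ.comp ψ))).symm
      | h1 a b => rfl
      | h2 x y hx hy =>
        exact (congrArg (rep π σ) (map_add (TensorProduct.map φ.toAlgHom.toLinearMap
          ψ.toAlgHom.toLinearMap : A ⊗[ℂ] B →ₗ[ℂ] C ⊗[ℂ] D) x y)).trans <|
          (map_add (rep π σ) _ _).trans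
          ((congrArg₂ (· + ·) hx hy).trans (map_add (rep (π.comp φ) (σ.comp ψ)) x y).symm)
    exact (congrArg norm (h x)).trans_le (norm_rep_le (π.comp φ) (σ.comp ψ) x)

end AlgTensor

/-- The minimal (spatial) tensor product of two unital C*-algebras: the completion of the algebraic
tensor product in the spatial norm. -/
def MinTensor (A B : Type u) [CStarAlgebra A] [CStarAlgebra B] : Type u :=
  UniformSpace.Completion (AlgTensor A B)

namespace MinTensor

variable {A B C D : Type u} [CStarAlgebra A] [CStarAlgebra B] [CStarAlgebra C] [CStarAlgebra D]

instance : NormedRing (MinTensor A B) :=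
  inferInstanceAs (NormedRing (UniformSpace.Completion (AlgTensor A B)))
instance : CompleteSpace (MinTensor A B) :=
  inferInstanceAs (CompleteSpace (UniformSpace.Completion (AlgTensor A B)))
instance : Algebra ℂ (MinTensor A B) :=
  inferInstanceAs (Algebra ℂ (UniformSpace.Completion (AlgTensor A B)))
instance : NormedAlgebra ℂ (MinTensor A B) where
  norm_smul_le := norm_smul_le (α := ℂ) (β := UniformSpace.Completion (AlgTensor A B))

/-- The canonical map from the algebraic to the completed tensor product. -/
def of : AlgTensor A B →L[ℂ] MinTensor A B :=
  (UniformSpace.Completion.toComplL : AlgTensor A B →L[ℂ] UniformSpace.Completion (AlgTensor A B))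

theorem norm_of (x : AlgTensor A B) : ‖of x‖ = ‖x‖ := UniformSpace.Completion.norm_coe x

theorem of_mul (x y : AlgTensor A B) : of (x * y) = of x * of y :=
  UniformSpace.Completion.coe_mul x y

theorem denseRange_of : DenseRange (of : AlgTensor A B → MinTensor A B) :=
  UniformSpace.Completion.denseRange_coe

theorem isUniformInducing_of : IsUniformInducing (of : AlgTensor A B → MinTensor A B) :=
  UniformSpace.Completion.isUniformInducing_coe (AlgTensor A B)

theorem induction {p : MinTensor A B → Prop} (x : MinTensor A B) (hp : IsClosed {x | p x})
    (h : ∀ x : AlgTensor A B, p (of x)) : p x :=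
  isClosed_property denseRange_of hp h x

/-- The elementary tensor `a ⊗ b` in the completed tensor product. -/
def tmul (a : A) (b : B) : MinTensor A B := of (AlgTensor.tmul a b)

/-- The continuous extension of the involution `(a ⊗ b)* = a* ⊗ b*`. -/
instance : Star (MinTensor A B) where
  star := UniformSpace.Completion.map (star : AlgTensor A B → AlgTensor A B)

theorem uniformContinuous_star :
    UniformContinuous (star : AlgTensor A B → AlgTensor A B) :=
  (LipschitzWith.of_dist_le_mul (K := 1) fun x y => by
    rw [dist_eq_norm, dist_eq_norm, ← star_sub, NNReal.coe_one, one_mul]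
    exact AlgTensor.norm_star_le _).uniformContinuous

theorem star_of (x : AlgTensor A B) : star (of x) = of (star x) :=
  UniformSpace.Completion.map_coe uniformContinuous_star x

theorem continuous_star' : Continuous (star : MinTensor A B → MinTensor A B) :=
  UniformSpace.Completion.continuous_map

instance : StarRing (MinTensor A B) where
  star_involutive x := by
    induction x using MinTensor.induction with
    | hp => exact isClosed_eq (continuous_star'.comp continuous_star') continuous_id
    | h x => rw [star_of, star_of, star_star]
  star_mul x y := by
    induction x using MinTensor.induction with
    | hp =>
        exact isClosed_eq (continuous_star'.comp (continuous_mul_const y))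
          ((continuous_const_mul _).comp continuous_star')
    | h x =>
      induction y using MinTensor.induction with
      | hp =>
          exact isClosed_eq (continuous_star'.comp (continuous_const_mul _))
            ((continuous_mul_const _).comp continuous_star')
      | h y => rw [← of_mul, star_of, star_of, star_of, star_mul, of_mul]
  star_add x y := by
    induction x using MinTensor.induction with
    | hp =>
        exact isClosed_eq (continuous_star'.comp (continuous_id.add continuous_const))
          (continuous_star'.add continuous_const)
    | h x =>
      induction y using MinTensor.induction with
      | hp =>
          exact isClosed_eq (continuous_star'.comp (continuous_const.add continuous_id))
            (continuous_const.add continuous_star')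
      | h y => rw [← map_add, star_of, star_of, star_of, star_add, map_add]

instance : StarModule ℂ (MinTensor A B) where
  star_smul c x := by
    induction x using MinTensor.induction with
    | hp =>
        exact isClosed_eq (continuous_star'.comp (continuous_const_smul c))
          ((continuous_const_smul _).comp continuous_star')
    | h x => rw [← map_smul, star_of, star_of, star_smul, map_smul]

instance : CStarRing (MinTensor A B) where
  norm_mul_self_le x := by
    induction x using MinTensor.induction with
    | hp =>
        exact isClosed_le (continuous_norm.mul continuous_norm)
          (continuous_norm.comp (continuous_star'.mul continuous_id))
    | h x =>
      rw [star_of, ← of_mul, norm_of, norm_of]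
      exact AlgTensor.norm_mul_self_le x

instance : CStarAlgebra (MinTensor A B) where

theorem norm_tmul_le (a : A) (b : B) : ‖tmul a b‖ ≤ ‖a‖ * ‖b‖ :=
  (norm_of _).trans_le (AlgTensor.norm_tmul_le a b)

/-- `(a, b) ↦ a ⊗ b` as a bounded bilinear map. -/
def tmulL (A B : Type u) [CStarAlgebra A] [CStarAlgebra B] : A →L[ℂ] B →L[ℂ] MinTensor A B :=
  LinearMap.mkContinuous₂ (LinearMap.mk₂ ℂ (tmul : A → B → MinTensor A B)
    (fun a a' b => (congrArg of (TensorProduct.add_tmul a a' b)).trans (map_add of _ _))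
    (fun c a b => (congrArg of (TensorProduct.smul_tmul' c a b).symm).trans (map_smul of c _))
    (fun a b b' => (congrArg of (TensorProduct.tmul_add a b b')).trans (map_add of _ _))
    (fun c a b => (congrArg of (TensorProduct.tmul_smul c a b)).trans (map_smul of c _))) 1
    fun a b => by rw [one_mul]; exact norm_tmul_le a b

theorem tmulL_apply (a : A) (b : B) : tmulL A B a b = tmul a b := rfl

/-- The tensor product `φ ⊗ ψ : A ⊗ B → C ⊗ D` of two unital `*`-homomorphisms, extended by
continuity to the minimal tensor products. -/
def map (φ : A →⋆ₐ[ℂ] C) (ψ : B →⋆ₐ[ℂ] D) : MinTensor A B →L[ℂ] MinTensor C D :=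
  (of.comp (AlgTensor.map φ ψ)).extend of

theorem map_tmul (φ : A →⋆ₐ[ℂ] C) (ψ : B →⋆ₐ[ℂ] D) (a : A) (b : B) :
    map φ ψ (tmul a b) = tmul (φ a) (ψ b) :=
  ContinuousLinearMap.extend_eq _ denseRange_of isUniformInducing_of _

end MinTensor

/-! ## Extension by continuity -/

/-- The map `ι x ↦ T x`, extended by continuity from the image of `ι`, takes the value `z` at `y`:
`T x → z` as `ι x → y`. -/
def ExtendsTo {X Y Z : Type*} [TopologicalSpace Y] [TopologicalSpace Z] (ι : X → Y) (T : X → Z)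
    (y : Y) (z : Z) : Prop :=
  Filter.Tendsto T (Filter.comap ι (𝓝 y)) (𝓝 z)

/-! ## Compact quantum groups -/

section CQG

variable (Q : Type u) [CStarAlgebra Q]

/-- The map `(a ⊗ b) ⊗ c ↦ (a ⊗ b) ⊗ c` from the algebraic to the completed tensor product. -/
def tripleOf : (Q ⊗[ℂ] Q) ⊗[ℂ] Q →ₗ[ℂ] MinTensor (MinTensor Q Q) Q :=
  TensorProduct.lift
    ((ContinuousLinearMap.coeLM ℂ).comp
      ((MinTensor.tmulL (MinTensor Q Q) Q).toLinearMap.comp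
        (TensorProduct.lift ((ContinuousLinearMap.coeLM ℂ).comp
          (MinTensor.tmulL Q Q).toLinearMap))))

/-- The map `(a ⊗ b) ⊗ c ↦ a ⊗ (b ⊗ c)` from the algebraic to the completed tensor product. -/
def tripleAssoc : (Q ⊗[ℂ] Q) ⊗[ℂ] Q →ₗ[ℂ] MinTensor Q (MinTensor Q Q) :=
  (TensorProduct.lift ((ContinuousLinearMap.coeLM ℂ).comp
      (MinTensor.tmulL Q (MinTensor Q Q)).toLinearMap)).comp
    ((TensorProduct.map LinearMap.id (TensorProduct.lift ((ContinuousLinearMap.coeLM ℂ).comp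
      (MinTensor.tmulL Q Q).toLinearMap))).comp
    (TensorProduct.assoc ℂ Q Q Q).toLinearMap)

theorem tripleOf_tmul (a b c : Q) :
    tripleOf Q ((a ⊗ₜ b) ⊗ₜ c) = MinTensor.tmul (MinTensor.tmul a b) c := rfl
theorem tripleAssoc_tmul (a b c : Q) :
    tripleAssoc Q ((a ⊗ₜ b) ⊗ₜ c) = MinTensor.tmul a (MinTensor.tmul b c) := rfl

/-- A compact quantum group structure on a unital C*-algebra `Q`: a coassociative unital
`*`-homomorphism `Δ : Q → Q ⊗ Q` such that the linear spans of `Δ(Q)(Q ⊗ 1)` and `Δ(Q)(1 ⊗ Q)` are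
norm dense. Coassociativity says that the canonical isomorphism `(Q ⊗ Q) ⊗ Q → Q ⊗ (Q ⊗ Q)`, which
is the continuous extension of the algebraic one, takes `(Δ ⊗ id)(Δ a)` to `(id ⊗ Δ)(Δ a)`. -/
structure CompactQuantumGroup where
  comul : Q →⋆ₐ[ℂ] MinTensor Q Q
  coassoc : ∀ a : Q, ExtendsTo (tripleOf Q) (tripleAssoc Q)
    (MinTensor.map comul (StarAlgHom.id ℂ Q) (comul a))
    (MinTensor.map (StarAlgHom.id ℂ Q) comul (comul a))
  dense_left : Dense
    (Submodule.span ℂ {x | ∃ a b : Q, x = comul a * MinTensor.tmul b 1} : Set (MinTensor Q Q))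
  dense_right : Dense
    (Submodule.span ℂ {x | ∃ a b : Q, x = comul a * MinTensor.tmul 1 b} : Set (MinTensor Q Q))

variable {Q} in
/-- The coproduct as a bounded linear map. -/
def CompactQuantumGroup.comulL (G : CompactQuantumGroup Q) : Q →L[ℂ] MinTensor Q Q :=
  G.comul.toAlgHom.toLinearMap.mkContinuous 1 fun a => by
    rw [one_mul]; exact NonUnitalStarAlgHom.norm_apply_le G.comul a

end CQG

/-! ## Smooth functions and one-forms with values in a C*-algebra -/

section Smooth

variable {E : Type*} [NormedAddCommGroup E] [NormedSpace ℝ E]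
  {H : Type*} [TopologicalSpace H] (I : ModelWithCorners ℝ E H)
  (M : Type*) [TopologicalSpace M] [ChartedSpace H M]

section Topology

variable {M} {W : Type*} [NormedAddCommGroup W] [NormedSpace ℂ W]

/-- A chart (centred at `c`), a compact set in the range of the chart, and an order of
differentiation. -/
structure ChartIndex where
  c : M
  K : Set E
  isCompact : IsCompact K
  subset : K ⊆ (extChartAt I c).target
  k : ℕ

/-- `sup_{y ∈ K} ‖D^k g(y)‖`, for a function `g` given in a chart. -/
def ChartIndex.supDeriv {I : ModelWithCorners ℝ E H} (i : ChartIndex (M := M) I) (g : E → W) : ℝ :=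
  ⨆ y : i.K, ‖iteratedFDerivWithin ℝ i.k g (extChartAt I i.c).target y‖

variable {I} (i : ChartIndex (M := M) I)

theorem ChartIndex.supDeriv_nonneg (g : E → W) : 0 ≤ i.supDeriv g :=
  Real.iSup_nonneg fun _ => norm_nonneg _

theorem ChartIndex.bddAbove {g : E → W}
    (hg : ContDiffOn ℝ ∞ g (extChartAt I i.c).target) :
    BddAbove (Set.range fun y : i.K =>
      ‖iteratedFDerivWithin ℝ i.k g (extChartAt I i.c).target y‖) := by
  have h := (hg.continuousOn_iteratedFDerivWithin (m := i.k) (by exact_mod_cast le_top)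
    (uniqueDiffOn_extChartAt_target i.c)).mono i.subset
  have := i.isCompact.bddAbove_image h.norm
  rwa [Set.image_eq_range] at this

theorem ChartIndex.supDeriv_add_le {g h : E → W}
    (hg : ContDiffOn ℝ ∞ g (extChartAt I i.c).target)
    (hh : ContDiffOn ℝ ∞ h (extChartAt I i.c).target) :
    i.supDeriv (g + h) ≤ i.supDeriv g + i.supDeriv h := by
  refine Real.iSup_le (fun y => ?_) (add_nonneg (i.supDeriv_nonneg g) (i.supDeriv_nonneg h))
  have hy := i.subset y.2
  have hk : ((i.k : ℕ∞) : WithTop ℕ∞) ≤ ∞ := by exact_mod_cast le_top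
  rw [iteratedFDerivWithin_add_apply ((hg y hy).of_le hk) ((hh y hy).of_le hk)
    (uniqueDiffOn_extChartAt_target i.c) hy]
  exact (norm_add_le _ _).trans
    (add_le_add (le_ciSup (i.bddAbove hg) y) (le_ciSup (i.bddAbove hh) y))

theorem ChartIndex.supDeriv_smul {g : E → W}
    (hg : ContDiffOn ℝ ∞ g (extChartAt I i.c).target) (a : ℂ) :
    i.supDeriv (a • g) = ‖a‖ * i.supDeriv g := by
  unfold ChartIndex.supDeriv
  rw [Real.mul_iSup_of_nonneg (norm_nonneg a)]
  congr 1
  funext y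
  have hy := i.subset y.2
  have hk : ((i.k : ℕ∞) : WithTop ℕ∞) ≤ ∞ := by exact_mod_cast le_top
  rw [iteratedFDerivWithin_const_smul_apply ((hg y hy).of_le hk)
    (uniqueDiffOn_extChartAt_target i.c) hy, norm_smul]

end Topology

variable (A : Type u) [CStarAlgebra A]

/-- The `*`-algebra of smooth `A`-valued functions on `M`, as functions. -/
def smoothStarSubalgebra : StarSubalgebra ℂ (M → A) where
  carrier := {F | ContMDiff I 𝓘(ℝ, A) ∞ F}
  mul_mem' {F G} hF hG := by
    have h : ContDiff ℝ ∞ fun p : A × A => p.1 * p.2 := contDiff_fst.mul contDiff_snd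
    exact h.comp_contMDiff (hF.prodMk_space hG)
  one_mem' := contMDiff_const
  add_mem' {F G} hF hG := hF.add hG
  zero_mem' := contMDiff_const
  algebraMap_mem' _ := contMDiff_const
  star_mem' {F} hF := (starL' ℝ : A ≃L[ℝ] A).contDiff.comp_contMDiff hF

/-- `C^∞(M, A)`, the smooth functions on `M` with values in the C*-algebra `A`. For `A = ℂ` this is
`C^∞(M)`; in general it is the completed tensor product of `C^∞(M)` with `A`. -/
def SmoothMap : Type _ := smoothStarSubalgebra I M A

namespace SmoothMap

instance : Ring (SmoothMap I M A) := inferInstanceAs (Ring (smoothStarSubalgebra I M A))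
instance : Algebra ℂ (SmoothMap I M A) :=
  inferInstanceAs (Algebra ℂ (smoothStarSubalgebra I M A))
instance : StarRing (SmoothMap I M A) :=
  inferInstanceAs (StarRing (smoothStarSubalgebra I M A))
instance : StarModule ℂ (SmoothMap I M A) :=
  inferInstanceAs (StarModule ℂ (smoothStarSubalgebra I M A))

instance : CoeFun (SmoothMap I M A) fun _ => M → A := ⟨fun F => F.1⟩

variable {I M A} {B : Type u} [CStarAlgebra B]

theorem contMDiff (F : SmoothMap I M A) : ContMDiff I 𝓘(ℝ, A) ∞ F := F.2

/-- The coordinate expression of a function in the chart at `c`. -/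
def inChart (F : SmoothMap I M A) (c : M) : E → A := F ∘ (extChartAt I c).symm

/-- The constant function with value `a`, i.e. `1 ⊗ a`. -/
def const (a : A) : SmoothMap I M A := ⟨fun _ => a, contMDiff_const⟩

variable {B' : Type v} [CStarAlgebra B'] in
/-- `id ⊗ T` for a bounded linear map `T`: the composition `m ↦ T (F m)`. -/
def mapVal (T : A →L[ℂ] B') : SmoothMap I M A →ₗ[ℂ] SmoothMap I M B' where
  toFun F := ⟨fun m => T (F m), (T.restrictScalars ℝ).contDiff.comp_contMDiff F.contMDiff⟩
  map_add' F G := Subtype.ext (funext fun m => map_add T (F m) (G m))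
  map_smul' c F := Subtype.ext (funext fun m => map_smul T c (F m))

/-- The map `f ⊗ a ↦ (m ↦ f(m) a)` from the algebraic tensor product `C^∞(M) ⊗ A` to
`C^∞(M, A)`. -/
def ofTensor : SmoothMap I M ℂ ⊗[ℂ] A →ₗ[ℂ] SmoothMap I M A :=
  TensorProduct.lift
    (LinearMap.flip
      { toFun := fun a => mapVal ((ContinuousLinearMap.id ℂ ℂ).smulRight a)
        map_add' := fun a b => LinearMap.ext fun f =>
          Subtype.ext (funext fun m => smul_add (f m) a b)
        map_smul' := fun c a => LinearMap.ext fun f =>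
          Subtype.ext (funext fun m => smul_comm (f m) c a) })

theorem ofTensor_tmul (f : SmoothMap I M ℂ) (a : A) (m : M) :
    ofTensor (f ⊗ₜ[ℂ] a) m = f m • a := rfl

/-- The map `F ⊗ b ↦ (m ↦ F(m) ⊗ b)` from the algebraic tensor product `C^∞(M, A) ⊗ B` to
`C^∞(M, A ⊗ B)`. -/
def tensorVal : SmoothMap I M A ⊗[ℂ] B →ₗ[ℂ] SmoothMap I M (MinTensor A B) :=
  TensorProduct.lift
    (LinearMap.flip
      { toFun := fun b => mapVal ((MinTensor.tmulL A B).flip b)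
        map_add' := fun b b' => LinearMap.ext fun F =>
          Subtype.ext (funext fun m => map_add (MinTensor.tmulL A B (F m)) b b')
        map_smul' := fun c b => LinearMap.ext fun F =>
          Subtype.ext (funext fun m => map_smul (MinTensor.tmulL A B (F m)) c b) })

theorem tensorVal_tmul (F : SmoothMap I M A) (b : B) (m : M) :
    tensorVal (F ⊗ₜ[ℂ] b) m = MinTensor.tmul (F m) b := rfl

variable [IsManifold I ∞ M]

theorem contDiffOn_inChart (F : SmoothMap I M A) (c : M) :
    ContDiffOn ℝ ∞ (F.inChart c) (extChartAt I c).target :=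
  contMDiffOn_iff_contDiffOn.mp
    (F.contMDiff.comp_contMDiffOn (contMDiffOn_extChartAt_symm c))

/-- The seminorm `F ↦ sup_K ‖D^k F‖`, computed in a chart. -/
def seminorm (i : ChartIndex (M := M) I) : Seminorm ℂ (SmoothMap I M A) :=
  Seminorm.of (fun F => i.supDeriv (F.inChart i.c))
    (fun F G => i.supDeriv_add_le (F.contDiffOn_inChart i.c) (G.contDiffOn_inChart i.c))
    (fun a F => i.supDeriv_smul (F.contDiffOn_inChart i.c) a)

/-- The Fréchet topology: uniform convergence of all derivatives on compact subsets of charts. -/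
instance : TopologicalSpace (SmoothMap I M A) :=
  ⨅ i : ChartIndex (M := M) I,
    (seminorm (A := A) i).toSeminormedAddCommGroup.toUniformSpace.toTopologicalSpace

end SmoothMap

/-! ## One-forms -/

variable {M A} in
/-- The coordinate expression of a (not necessarily smooth) `A`-valued one-form in the chart `φ` at
`c`: its pullback under `φ⁻¹`. Its value at `y` on the `j`-th basis vector is the coefficient of
`dx_j`. -/
def formInChart (θ : ∀ m : M, TangentSpace I m →L[ℝ] A) (c : M) (y : E) : E →L[ℝ] A :=
  (θ ((extChartAt I c).symm y)).comp
    (mfderivWithin 𝓘(ℝ, E) I (extChartAt I c).symm (Set.range I) y)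

/-- The space of `A`-valued one-forms with smooth coefficients in all charts, as a space of
families of real linear maps `T_m M → A`. -/
def oneFormSubmodule : Submodule ℂ (∀ m : M, TangentSpace I m →L[ℝ] A) where
  carrier := {θ | ∀ c : M, ContDiffOn ℝ ∞ (formInChart I θ c) (extChartAt I c).target}
  add_mem' hθ hη c := (hθ c).add (hη c)
  zero_mem' _ := contDiffOn_const (c := (0 : E →L[ℝ] A))
  smul_mem' a _ hθ c := (hθ c).const_smul a

/-- The smooth one-forms on `M` with values in the C*-algebra `A`. For `A = ℂ` these are the
complex one-forms `Ω¹(C^∞(M))`; in general they form the completed tensor product of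
`Ω¹(C^∞(M))` with `A`. -/
def OneForm : Type _ := oneFormSubmodule I M A

namespace OneForm

instance : AddCommGroup (OneForm I M A) := inferInstanceAs (AddCommGroup (oneFormSubmodule I M A))
instance : Module ℂ (OneForm I M A) := inferInstanceAs (Module ℂ (oneFormSubmodule I M A))

instance : CoeFun (OneForm I M A) fun _ => ∀ m : M, TangentSpace I m →L[ℝ] A := ⟨fun θ => θ.1⟩

variable {I M A}

theorem contDiffOn_inChart (θ : OneForm I M A) (c : M) :
    ContDiffOn ℝ ∞ (formInChart I θ c) (extChartAt I c).target := θ.2 c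

theorem inChart_add (θ η : OneForm I M A) (c : M) :
    formInChart I (θ + η : OneForm I M A) c = formInChart I θ c + formInChart I η c := by
  funext y
  exact ContinuousLinearMap.add_comp _ _ _

theorem inChart_smul (a : ℂ) (θ : OneForm I M A) (c : M) :
    formInChart I (a • θ : OneForm I M A) c = a • formInChart I θ c := by
  funext y
  exact ContinuousLinearMap.smul_comp _ _ _

variable [IsManifold I ∞ M]

/-- The seminorm `θ ↦ sup_K ‖D^k θ‖`, computed from the coefficients of `θ` in a chart. -/
def seminorm (i : ChartIndex (M := M) I) : Seminorm ℂ (OneForm I M A) :=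
  Seminorm.of (fun θ => i.supDeriv (formInChart I θ i.c))
    (fun θ η => by
      rw [inChart_add]
      exact i.supDeriv_add_le (θ.contDiffOn_inChart i.c) (η.contDiffOn_inChart i.c))
    (fun a θ => by
      rw [inChart_smul]
      exact i.supDeriv_smul (θ.contDiffOn_inChart i.c) a)

/-- The Fréchet topology: uniform convergence of all derivatives of the coefficients on compact
subsets of charts. -/
instance : TopologicalSpace (OneForm I M A) :=
  ⨅ i : ChartIndex (M := M) I,
    (seminorm (A := A) i).toSeminormedAddCommGroup.toUniformSpace.toTopologicalSpace

/-- The left multiplication `(F θ)(m) = F(m) θ(m)` of a form by a function. -/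
def lmul (F : SmoothMap I M A) (θ : OneForm I M A) : OneForm I M A :=
  ⟨fun m => (ContinuousLinearMap.mul ℝ A (F m)).comp (θ m), fun c =>
    ContDiffOn.clm_comp (g := fun y => ContinuousLinearMap.mul ℝ A (F.inChart c y))
      ((ContinuousLinearMap.mul ℝ A).contDiff.comp_contDiffOn (F.contDiffOn_inChart c))
      (θ.contDiffOn_inChart c)⟩

/-- The right multiplication `(θ F)(m) = θ(m) F(m)` of a form by a function. -/
def rmul (θ : OneForm I M A) (F : SmoothMap I M A) : OneForm I M A :=
  ⟨fun m => ((ContinuousLinearMap.mul ℝ A).flip (F m)).comp (θ m), fun c =>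
    ContDiffOn.clm_comp (g := fun y => (ContinuousLinearMap.mul ℝ A).flip (F.inChart c y))
      ((ContinuousLinearMap.mul ℝ A).flip.contDiff.comp_contDiffOn (F.contDiffOn_inChart c))
      (θ.contDiffOn_inChart c)⟩

theorem lmul_apply (F : SmoothMap I M A) (θ : OneForm I M A) (m : M) (v : TangentSpace I m) :
    lmul F θ m v = F m * θ m v := rfl

theorem rmul_apply (θ : OneForm I M A) (F : SmoothMap I M A) (m : M) (v : TangentSpace I m) :
    rmul θ F m v = θ m v * F m := rfl

variable (I) in
theorem formInChart_mfderiv (F : SmoothMap I M A) (c : M) {y : E}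
    (hy : y ∈ (extChartAt I c).target) :
    formInChart I (fun m => (mfderiv I 𝓘(ℝ, A) F m : TangentSpace I m →L[ℝ] A)) c y =
      fderivWithin ℝ (F.inChart c) (extChartAt I c).target y := by
  have h1 : UniqueMDiffWithinAt 𝓘(ℝ, E) (Set.range I) y :=
    (I.uniqueDiffOn y (extChartAt_target_subset_range c hy)).uniqueMDiffWithinAt
  have h2 := mfderiv_comp_mfderivWithin (I := 𝓘(ℝ, E)) (I' := I) (I'' := 𝓘(ℝ, A)) y
    ((F.contMDiff.mdifferentiable (by simp)) ((extChartAt I c).symm y))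
    (mdifferentiableWithinAt_extChartAt_symm (I := I) hy) h1
  rw [mfderivWithin_eq_fderivWithin] at h2
  have h3 : fderivWithin ℝ (F.inChart c) (extChartAt I c).target y =
      fderivWithin ℝ (F.inChart c) (Set.range I) y :=
    fderivWithin_congr_set (extChartAt_target_eventuallyEq_of_mem hy)
  rw [h3]
  exact h2.symm

end OneForm

variable {I M A} in
/-- The exterior derivative `d : C^∞(M, A) → Ω¹(M, A)`, `F ↦ dF`. For `A = ℂ` this is the usual `d`
on `C^∞(M)`; in general it is `d ⊗ id`. -/
def SmoothMap.d [IsManifold I ∞ M] (F : SmoothMap I M A) :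
    OneForm I M A :=
  ⟨fun m => mfderiv I 𝓘(ℝ, A) F m, fun c =>
    ((F.contDiffOn_inChart c).fderivWithin (uniqueDiffOn_extChartAt_target c)
      (by simp)).congr fun _ hy => OneForm.formInChart_mfderiv I F c hy⟩

variable {I M A} in
theorem SmoothMap.d_apply [IsManifold I ∞ M]
    (F : SmoothMap I M A) (m : M) : F.d m = mfderiv I 𝓘(ℝ, A) F m := rfl

variable {I M A} in
/-- `(ν ⊗ id) F`, the derivative `m ↦ dF_m(ν_m)` of `F` along a vector field `ν`. -/
def SmoothMap.along [IsManifold I ∞ M]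
    (ν : Cₛ^∞⟮I; E, (TangentSpace I : M → Type _)⟯) (F : SmoothMap I M A) : M → A :=
  fun m => mfderiv I 𝓘(ℝ, A) F m (ν m)

/-! ## Smooth actions -/

/-- A smooth action of a compact quantum group `(Q, Δ)` on the manifold `M`: a Fréchet continuous
unital `*`-homomorphism `α : C^∞(M) → C^∞(M, Q)` such that

* `(α ⊗ id) α = (id ⊗ Δ) α`, where `α ⊗ id : C^∞(M, Q) → C^∞(M, Q ⊗ Q)` is the continuous extension
  of the algebraic map `f ⊗ q ↦ α(f) ⊗ q`;
* the linear span of `α(C^∞(M))(1 ⊗ Q)` is Fréchet dense in `C^∞(M, Q)`;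
* `α` preserves the ideal of functions that vanish on the boundary of `M`. -/
structure SmoothAction [IsManifold I ∞ M] {Q : Type u} [CStarAlgebra Q]
    (G : CompactQuantumGroup Q) where
  toHom : SmoothMap I M ℂ →⋆ₐ[ℂ] SmoothMap I M Q
  continuous : Continuous toHom
  coassoc : ∀ f : SmoothMap I M ℂ,
    ExtendsTo (SmoothMap.ofTensor : SmoothMap I M ℂ ⊗[ℂ] Q →ₗ[ℂ] SmoothMap I M Q)
      (SmoothMap.tensorVal ∘ₗ TensorProduct.map toHom.toAlgHom.toLinearMap LinearMap.id)
      (toHom f)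
      (SmoothMap.mapVal G.comulL (toHom f))
  dense : Dense (Submodule.span ℂ
    {F | ∃ (f : SmoothMap I M ℂ) (q : Q), F = toHom f * SmoothMap.const q} :
      Set (SmoothMap I M Q))
  boundary : ∀ f : SmoothMap I M ℂ, (∀ m ∈ I.boundary M, f m = 0) →
    ∀ m ∈ I.boundary M, toHom f m = 0

instance [IsManifold I ∞ M] {Q : Type u} [CStarAlgebra Q] (G : CompactQuantumGroup Q) :
    CoeFun (SmoothAction I M G) fun _ => SmoothMap I M ℂ → SmoothMap I M Q := ⟨fun α => α.toHom⟩

end Smooth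

end

noncomputable section

/-! ## Hadamard's lemma on convex sets -/

section Hadamard

open MeasureTheory intervalIntegral

variable {E : Type u} [NormedAddCommGroup E] [NormedSpace ℝ E]

/-- Differentiation under the integral sign over `[0, 1]`, within a convex set. -/
theorem Convex.hasFDerivWithinAt_intervalIntegral {W : Type*} [NormedAddCommGroup W]
    [NormedSpace ℝ W] [CompleteSpace W] {s : Set E} (hs : Convex ℝ s) {F : ℝ → E → W}
    {F' : ℝ → E → E →L[ℝ] W}
    (hF : ∀ y ∈ s, ContinuousOn (F · y) (Set.Icc 0 1))
    (hF' : ContinuousOn (Function.uncurry F') (Set.Icc 0 1 ×ˢ s))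
    (hd : ∀ t ∈ Set.Icc (0 : ℝ) 1, ∀ y ∈ s, HasFDerivWithinAt (F t) (F' t y) s y)
    {y : E} (hy : y ∈ s) :
    HasFDerivWithinAt (fun y => ∫ t in (0 : ℝ)..1, F t y) (∫ t in (0 : ℝ)..1, F' t y) s y := by
  have hint : ∀ z ∈ s, IntervalIntegrable (F · z) volume 0 1 := fun z hz =>
    (by simpa using hF z hz : ContinuousOn (F · z) (Set.uIcc 0 1)).intervalIntegrable
  have hc' : ContinuousOn (F' · y) (Set.Icc 0 1) :=
    hF'.comp (f := fun t => (t, y)) (by fun_prop) fun t ht => ⟨ht, hy⟩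
  have hint' : IntervalIntegrable (F' · y) volume 0 1 :=
    (by simpa using hc' : ContinuousOn (F' · y) (Set.uIcc 0 1)).intervalIntegrable
  rw [hasFDerivWithinAt_iff_isLittleO, Asymptotics.isLittleO_iff]
  intro ε hε
  have hunif : ∀ᶠ z in 𝓝[s] y, ∀ t ∈ Set.Icc (0 : ℝ) 1, ‖F' t z - F' t y‖ ≤ ε := by
    have hu := (isCompact_Icc (a := (0 : ℝ)) (b := 1)).mem_uniformity_of_prod
      (f := fun z t => F' t z) (q := y) (s := s)
      (hF'.comp (f := fun p : E × ℝ => (p.2, p.1)) (by fun_prop) fun p hp => ⟨hp.2, hp.1⟩) hy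
      (Metric.dist_mem_uniformity hε)
    obtain ⟨v, hv, hvε⟩ := hu
    filter_upwards [hv] with z hz t ht
    have := hvε z hz t ht
    rw [Set.mem_ofPred_eq, dist_eq_norm] at this
    exact this.le
  obtain ⟨δ, hδ, hball⟩ := Metric.mem_nhdsWithin_iff.1 hunif
  have hmem : s ∩ Metric.ball y δ ∈ 𝓝[s] y :=
    Filter.inter_mem self_mem_nhdsWithin (mem_nhdsWithin_of_mem_nhds (Metric.ball_mem_nhds y hδ))
  filter_upwards [hmem] with z hz
  have key : ∀ t ∈ Set.Icc (0 : ℝ) 1, ‖F t z - F t y - F' t y (z - y)‖ ≤ ε * ‖z - y‖ := by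
    intro t ht
    refine (hs.inter (convex_ball y δ)).norm_image_sub_le_of_norm_hasFDerivWithin_le'
      (f := F t) (f' := F' t) (fun w hw => (hd t ht w hw.1).mono Set.inter_subset_left)
      (fun w hw => hball ⟨hw.2, hw.1⟩ t ht) ⟨hy, Metric.mem_ball_self hδ⟩ hz
  have hintv : IntervalIntegrable (fun t => F' t y (z - y)) volume 0 1 :=
    (by rw [Set.uIcc_of_le zero_le_one]; exact hc'.clm_apply continuousOn_const :
      ContinuousOn (fun t => F' t y (z - y)) (Set.uIcc 0 1)).intervalIntegrable
  rw [ContinuousLinearMap.intervalIntegral_apply hint', ← integral_sub (hint z hz.1) (hint y hy),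
    ← integral_sub ((hint z hz.1).sub (hint y hy)) hintv]
  have := norm_integral_le_of_norm_le_const (a := (0 : ℝ)) (b := 1) (C := ε * ‖z - y‖)
    (f := fun t => F t z - F t y - F' t y (z - y)) fun t ht => key t (by
      rw [Set.uIoc_of_le zero_le_one] at ht; exact Set.Ioc_subset_Icc_self ht)
  simpa using this

theorem Convex.contDiffOn_integral_lineMap {W : Type u} [NormedAddCommGroup W] [NormedSpace ℝ W]
    [CompleteSpace W] {s : Set E} (hs : Convex ℝ s) (hu : UniqueDiffOn ℝ s) {p : E} (hp : p ∈ s)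
    {Φ : E → W} (hΦ : ContDiffOn ℝ ∞ Φ s) (k : ℕ) :
    ContDiffOn ℝ ∞ (fun y => ∫ t in (0 : ℝ)..1, t ^ k • Φ (p + t • (y - p))) s := by
  have hmaps : ∀ t ∈ Set.Icc (0 : ℝ) 1, ∀ y ∈ s, p + t • (y - p) ∈ s := fun t ht y hy =>
    hs.add_smul_sub_mem hp hy ht
  have main : ∀ (W : Type u) [NormedAddCommGroup W] [NormedSpace ℝ W] [CompleteSpace W]
      (Φ : E → W), ContDiffOn ℝ ∞ Φ s → ∀ k : ℕ, ∀ y ∈ s, HasFDerivWithinAt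
        (fun y => ∫ t in (0 : ℝ)..1, t ^ k • Φ (p + t • (y - p)))
        (∫ t in (0 : ℝ)..1, t ^ (k + 1) • fderivWithin ℝ Φ s (p + t • (y - p))) s y := by
    intro W _ _ _ Φ hΦ k y hy
    refine hs.hasFDerivWithinAt_intervalIntegral (F := fun t y => t ^ k • Φ (p + t • (y - p)))
      (F' := fun t y => t ^ (k + 1) • fderivWithin ℝ Φ s (p + t • (y - p))) ?_ ?_ ?_ hy
    · intro y hy
      exact (by fun_prop : ContinuousOn (fun t : ℝ => t ^ k) _).smul
        (hΦ.continuousOn.comp (f := fun t : ℝ => p + t • (y - p)) (by fun_prop)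
          fun t ht => hmaps t ht y hy)
    · have h1 := hΦ.continuousOn_fderivWithin hu (by simp)
      exact (by fun_prop : ContinuousOn (fun q : ℝ × E => q.1 ^ (k + 1)) _).smul
        (h1.comp (f := fun q : ℝ × E => p + q.1 • (q.2 - p)) (by fun_prop)
          fun q hq => hmaps q.1 hq.1 q.2 hq.2)
    · intro t ht y hy
      have h1 : HasFDerivWithinAt (fun y => p + t • (y - p)) (t • ContinuousLinearMap.id ℝ E) s y :=
        (((hasFDerivWithinAt_id y s).sub_const p).const_smul t).const_add p
      have h2 := ((hΦ.differentiableOn (by simp) _ (hmaps t ht y hy)).hasFDerivWithinAt.comp y h1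
        (fun z hz => hmaps t ht z hz)).const_smul (t ^ k)
      refine h2.congr_fderiv ?_
      ext v
      simp [pow_succ, mul_smul]
  rw [contDiffOn_infty]
  intro n
  induction n generalizing W k with
  | zero =>
    rw [Nat.cast_zero, contDiffOn_zero]
    exact fun y hy => (main W Φ hΦ k y hy).continuousWithinAt
  | succ n ih =>
    rw [Nat.cast_add, Nat.cast_one, contDiffOn_succ_iff_hasFDerivWithinAt_of_uniqueDiffOn hu]
    exact ⟨fun h => by simp at h, _, ih (hΦ.fderivWithin hu (by simp)) (k + 1),
      fun y hy => main W Φ hΦ k y hy⟩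

/-- **Hadamard's lemma**: a smooth function on a convex set is `F y = F p + A(y) (y - p)` with a
smooth family `A` of linear forms. -/
theorem Convex.exists_hadamard {s : Set E} (hs : Convex ℝ s) (hu : UniqueDiffOn ℝ s) {p : E}
    (hp : p ∈ s) {F : E → ℂ} (hF : ContDiffOn ℝ ∞ F s) :
    ∃ A : E → E →L[ℝ] ℂ, ContDiffOn ℝ ∞ A s ∧ A p = fderivWithin ℝ F s p ∧
      ∀ y ∈ s, F y - F p = A y (y - p) := by
  have hF' := hF.fderivWithin (m := ∞) hu (by simp)
  have hmaps : ∀ y ∈ s, ∀ t ∈ Set.Icc (0 : ℝ) 1, p + t • (y - p) ∈ s := fun y hy t ht =>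
    hs.add_smul_sub_mem hp hy ht
  refine ⟨_, hs.contDiffOn_integral_lineMap hu hp hF' 0, by simp, fun y hy => ?_⟩
  have hline : Continuous fun t : ℝ => p + t • (y - p) := by fun_prop
  have hc : ContinuousOn (fun t : ℝ => fderivWithin ℝ F s (p + t • (y - p))) (Set.uIcc 0 1) := by
    rw [Set.uIcc_of_le zero_le_one]
    exact hF'.continuousOn.comp hline.continuousOn (hmaps y hy)
  simp only [pow_zero, one_smul]
  rw [ContinuousLinearMap.intervalIntegral_apply hc.intervalIntegrable]
  rw [integral_eq_sub_of_hasDeriv_right (f := fun t : ℝ => F (p + t • (y - p)))]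
  · simp
  · rw [Set.uIcc_of_le zero_le_one]
    exact hF.continuousOn.comp hline.continuousOn (hmaps y hy)
  · intro t ht
    rw [min_eq_left zero_le_one, max_eq_right zero_le_one] at ht
    have h1 : HasDerivWithinAt (fun t : ℝ => p + t • (y - p)) (y - p) (Set.Icc 0 1) t := by
      simpa using (((hasDerivAt_id t).smul_const (y - p)).const_add p).hasDerivWithinAt
    have h2 := (hF.differentiableOn (by simp) _
      (hmaps y hy t (Set.Ioo_subset_Icc_self ht))).hasFDerivWithinAt.comp_hasDerivWithinAt t h1
      (hmaps y hy)
    exact (h2.hasDerivAt (Icc_mem_nhds ht.1 ht.2)).hasDerivWithinAt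
  · exact (hc.clm_apply continuousOn_const).intervalIntegrable

end Hadamard

section SmoothMapAPI

variable {E : Type*} [NormedAddCommGroup E] [NormedSpace ℝ E]
  {H : Type*} [TopologicalSpace H] {I : ModelWithCorners ℝ E H}
  {M : Type*} [TopologicalSpace M] [ChartedSpace H M] {A : Type u} [CStarAlgebra A]

namespace SmoothMap

@[ext]
theorem ext {F G : SmoothMap I M A} (h : ∀ m, F m = G m) : F = G := Subtype.ext (funext h)

@[simp] theorem mul_apply (F G : SmoothMap I M A) (m : M) : (F * G) m = F m * G m := rfl
@[simp] theorem add_apply (F G : SmoothMap I M A) (m : M) : (F + G) m = F m + G m := rfl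
@[simp] theorem sub_apply (F G : SmoothMap I M A) (m : M) : (F - G) m = F m - G m := rfl
@[simp] theorem zero_apply (m : M) : (0 : SmoothMap I M A) m = 0 := rfl
@[simp] theorem one_apply (m : M) : (1 : SmoothMap I M A) m = 1 := rfl
@[simp] theorem smul_apply (c : ℂ) (F : SmoothMap I M A) (m : M) : (c • F) m = c • F m := rfl
@[simp] theorem star_apply (F : SmoothMap I M A) (m : M) : (star F) m = star (F m) := rfl

/-- Evaluation at a point. -/
def eval (m : M) : SmoothMap I M A →⋆ₐ[ℂ] A where
  toFun F := F m
  map_one' := rfl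
  map_mul' _ _ := rfl
  map_zero' := rfl
  map_add' _ _ := rfl
  commutes' _ := rfl
  map_star' _ := rfl

@[simp] theorem sum_apply {ι : Type*} (s : Finset ι) (F : ι → SmoothMap I M A) (m : M) :
    (∑ i ∈ s, F i) m = ∑ i ∈ s, F i m := map_sum (eval m) F s

theorem mul_comm_complex (f g : SmoothMap I M ℂ) : f * g = g * f :=
  ext fun _ => mul_comm _ _

/-- A smooth real function as a complex-valued one. -/
def ofReal (f : M → ℝ) (hf : ContMDiff I 𝓘(ℝ) ∞ f) : SmoothMap I M ℂ :=
  ⟨fun m => f m, Complex.ofRealCLM.contDiff.comp_contMDiff hf⟩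

@[simp] theorem ofReal_apply (f : M → ℝ) (hf : ContMDiff I 𝓘(ℝ) ∞ f) (m : M) :
    ofReal f hf m = f m := rfl

theorem mdifferentiableAt (F : SmoothMap I M A) (m : M) : MDifferentiableAt I 𝓘(ℝ, A) F m :=
  F.contMDiff.mdifferentiable (by simp) m

/-- The derivative of a smooth function along a tangent vector, as a linear map. -/
def derivAt (m : M) (v : TangentSpace I m) : SmoothMap I M A →ₗ[ℂ] A where
  toFun F := (mfderiv I 𝓘(ℝ, A) F m : TangentSpace I m →L[ℝ] A) v
  map_add' F G := by
    have h := ((F.mdifferentiableAt m).hasMFDerivAt.add (G.mdifferentiableAt m).hasMFDerivAt).mfderiv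
    exact congrArg (fun L : TangentSpace I m →L[ℝ] A => L v) h
  map_smul' c F := by
    let L : A →L[ℝ] A := (c • ContinuousLinearMap.id ℂ A).restrictScalars ℝ
    have h := (L.hasMFDerivAt (x := F m)).comp m (F.mdifferentiableAt m).hasMFDerivAt
    exact congrArg (fun L : TangentSpace I m →L[ℝ] A => L v) h.mfderiv

theorem derivAt_mul (m : M) (v : TangentSpace I m) (F G : SmoothMap I M A) :
    derivAt m v (F * G) = F m * derivAt m v G + derivAt m v F * G m := by
  have h := ((F.mdifferentiableAt m).hasMFDerivAt.mul' (G.mdifferentiableAt m).hasMFDerivAt).mfderiv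
  exact congrArg (fun L : TangentSpace I m →L[ℝ] A => L v) h

theorem derivAt_algebraMap (m : M) (v : TangentSpace I m) (c : ℂ) :
    derivAt m v (algebraMap ℂ (SmoothMap I M A) c) = 0 := by
  have h : derivAt m v (1 : SmoothMap I M A) = 0 := by
    simpa using derivAt_mul m v (1 : SmoothMap I M A) 1
  rw [Algebra.algebraMap_eq_smul_one, map_smul, h, smul_zero]

end SmoothMap

end SmoothMapAPI

section ManifoldHadamard

variable {E : Type*} [NormedAddCommGroup E] [NormedSpace ℝ E] [FiniteDimensional ℝ E]
  {H : Type*} [TopologicalSpace H] {I : ModelWithCorners ℝ E H}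
  {M : Type*} [TopologicalSpace M] [ChartedSpace H M] [IsManifold I ∞ M] [T2Space M]

/-- The products of two smooth functions that vanish at `p`. -/
def SmoothMap.vanishingProducts (I : ModelWithCorners ℝ E H) (p : M) : Set (SmoothMap I M ℂ) :=
  {a | ∃ f g : SmoothMap I M ℂ, f p = 0 ∧ g p = 0 ∧ a = f * g}

/-- A smooth function that vanishes to first order at `p` is a sum of products of functions that
vanish at `p`. -/
theorem SmoothMap.mem_closure_vanishingProducts (G : SmoothMap I M ℂ) (p : M) (h0 : G p = 0)
    (h1 : mfderiv I 𝓘(ℝ, ℂ) G p = 0) :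
    G ∈ AddSubmonoid.closure (SmoothMap.vanishingProducts I p) := by
  set φ := extChartAt I p with hφ
  obtain ⟨r, hr, hball⟩ := Metric.mem_nhdsWithin_iff.1 (extChartAt_target_mem_nhdsWithin (I := I) p)
  set s := Metric.ball (φ p) r ∩ Set.range I with hs
  have hps : φ p ∈ s := ⟨Metric.mem_ball_self hr, by simp [φ]⟩
  have hconv : Convex ℝ s := (convex_ball _ _).inter I.convex_range
  have huniq : UniqueDiffOn ℝ s := by
    rw [hs, Set.inter_comm]; exact I.uniqueDiffOn.inter Metric.isOpen_ball
  obtain ⟨A, hA, hAp, hAeq⟩ := hconv.exists_hadamard huniq hps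
    ((G.contDiffOn_inChart p).mono hball)
  have hAp0 : A (φ p) = 0 := by
    rw [hAp, hs, Set.inter_comm, fderivWithin_inter (Metric.ball_mem_nhds _ hr)]
    exact (G.mdifferentiableAt p).mfderiv.symm.trans h1
  have hopen : φ ⁻¹' Metric.ball (φ p) r ∩ φ.source ∈ 𝓝 p :=
    Filter.inter_mem ((continuousAt_extChartAt p).preimage_mem_nhds (Metric.ball_mem_nhds _ hr))
      (extChartAt_source_mem_nhds p)
  obtain ⟨σ, -, hσ⟩ := (SmoothBumpFunction.nhds_basis_tsupport (I := I) p).mem_iff.1 hopen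
  have hin : ∀ m ∈ tsupport σ, φ m ∈ s := fun m hm =>
    ⟨(hσ hm).1, extChartAt_target_subset_range p (φ.map_source (hσ hm).2)⟩
  -- functions of the coordinates near `p`, cut off
  have hsm : ∀ g : E → ℂ, ContDiffOn ℝ ∞ g s →
      ContMDiff I 𝓘(ℝ, ℂ) ∞ fun m => (σ m : ℂ) * g (φ m) := by
    intro g hg
    have : ContMDiff I 𝓘(ℝ, ℂ) ∞ fun m => σ m • g (φ m) := by
      refine contMDiff_of_tsupport fun m hm => ?_
      have hm' : m ∈ tsupport σ := tsupport_smul_subset_left _ _ hm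
      have hms := (hσ hm').2
      refine σ.contMDiffAt.smul ?_
      have h2 : ContMDiffWithinAt I 𝓘(ℝ, E) ∞ φ (φ ⁻¹' Metric.ball (φ p) r ∩ φ.source) m :=
        (contMDiffAt_extChartAt' (by rwa [← extChartAt_source I])).contMDiffWithinAt
      refine ContMDiffWithinAt.contMDiffAt (s := φ ⁻¹' Metric.ball (φ p) r ∩ φ.source) ?_ ?_
      · exact ((hg _ (hin m hm')).contMDiffWithinAt).comp m h2 fun z hz =>
          ⟨hz.1, extChartAt_target_subset_range p (φ.map_source hz.2)⟩
      · rw [Set.inter_comm]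
        exact ((continuousOn_extChartAt p).isOpen_inter_preimage (isOpen_extChartAt_source p)
          Metric.isOpen_ball).mem_nhds ⟨hms, (hσ hm').1⟩
    simpa only [Complex.real_smul] using this
  let b := Module.finBasis ℝ E
  let u : Fin (Module.finrank ℝ E) → SmoothMap I M ℂ := fun j =>
    ⟨_, hsm (fun y => ((b.equivFunL (y - φ p) j : ℝ) : ℂ)) (by
      refine (Complex.ofRealCLM.contDiff.comp ?_).contDiffOn
      exact (contDiff_apply ℝ ℝ j).comp
        (b.equivFunL.contDiff.comp (contDiff_id.sub contDiff_const)))⟩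
  let w : Fin (Module.finrank ℝ E) → SmoothMap I M ℂ := fun j =>
    ⟨_, hsm (fun y => A y (b j)) (hA.clm_apply contDiffOn_const)⟩
  let σ' : SmoothMap I M ℂ := .ofReal σ σ.contMDiff
  have hG : G = (∑ j, u j * w j) + (1 - σ' * σ') * G := by
    ext m
    have hkey : (σ m : ℂ) * G m = (σ m : ℂ) * A (φ m) (φ m - φ p) := by
      by_cases hm : m ∈ tsupport σ
      · have h3 := hAeq _ (hin m hm)
        simp only [SmoothMap.inChart, Function.comp_apply] at h3
        rw [φ.left_inv (hσ hm).2, φ.left_inv (mem_extChartAt_source p), h0, sub_zero] at h3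
        rw [h3]
      · simp [image_eq_zero_of_notMem_tsupport hm]
    have hsum : A (φ m) (φ m - φ p) =
        ∑ j, ((b.equivFunL (φ m - φ p) j : ℝ) : ℂ) * A (φ m) (b j) := by
      conv_lhs => rw [← b.sum_equivFun (φ m - φ p), map_sum]
      refine Finset.sum_congr rfl fun j _ => ?_
      rw [map_smul, Complex.real_smul]; rfl
    have hsum' : (∑ j, u j * w j) m = (σ m : ℂ) * (σ m * G m) := by
      rw [hkey, hsum, SmoothMap.sum_apply, Finset.mul_sum, Finset.mul_sum]
      refine Finset.sum_congr rfl fun j _ => ?_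
      change (σ m : ℂ) * ((b.equivFunL (φ m - φ p) j : ℝ) : ℂ) * (σ m * A (φ m) (b j)) = _
      ring
    rw [SmoothMap.add_apply, hsum']
    simp only [SmoothMap.mul_apply, SmoothMap.sub_apply, SmoothMap.one_apply, σ',
      SmoothMap.ofReal_apply]
    ring
  rw [hG]
  refine add_mem (sum_mem fun j _ => AddSubmonoid.subset_closure ⟨u j, w j, ?_, ?_, rfl⟩)
    (AddSubmonoid.subset_closure ⟨_, G, ?_, h0, rfl⟩)
  · change (σ p : ℂ) * ((b.equivFunL (φ p - φ p) j : ℝ) : ℂ) = 0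
    simp
  · change (σ p : ℂ) * A (φ p) (b j) = 0
    simp [hAp0]
  · simp [σ']

end ManifoldHadamard

section Key

variable {E : Type*} [NormedAddCommGroup E] [NormedSpace ℝ E]
  {H : Type*} [TopologicalSpace H] {I : ModelWithCorners ℝ E H}
  {M : Type*} [TopologicalSpace M] [ChartedSpace H M]
  {Q : Type u} [CStarAlgebra Q]

section Order

variable [PartialOrder Q]

/-- The estimate `q* q ≤ π(k)` for a smooth real function `k` that
vanishes at `p`. -/
def SmoothMap.VanishesAt (π : SmoothMap I M ℂ →⋆ₐ[ℂ] Q) (p : M) (q : Q) : Prop :=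
  ∃ (k : M → ℝ) (hk : ContMDiff I 𝓘(ℝ) ∞ k), k p = 0 ∧ star q * q ≤ π (.ofReal k hk)

namespace SmoothMap.VanishesAt

variable {π : SmoothMap I M ℂ →⋆ₐ[ℂ] Q} {p : M}

theorem zero : VanishesAt π p 0 := by
  refine ⟨0, contMDiff_const, rfl, ?_⟩
  have : SmoothMap.ofReal (I := I) (M := M) 0 contMDiff_const = 0 := by ext m; simp
  rw [this, map_zero]; simp

variable [StarOrderedRing Q]

theorem add {q r : Q} (hq : VanishesAt π p q) (hr : VanishesAt π p r) :
    VanishesAt π p (q + r) := by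
  obtain ⟨k, hk, hkp, hqk⟩ := hq
  obtain ⟨l, hl, hlp, hrl⟩ := hr
  refine ⟨fun m => 2 * (k m + l m), contMDiff_const.mul (hk.add hl), by simp [hkp, hlp], ?_⟩
  have h1 : SmoothMap.ofReal (fun m => 2 * (k m + l m)) (contMDiff_const.mul (hk.add hl)) =
      (ofReal k hk + ofReal l hl) + (ofReal k hk + ofReal l hl) := by
    ext m; simp only [ofReal_apply, add_apply]; push_cast; ring
  rw [h1, map_add, map_add]
  have h2 : 0 ≤ star (q - r) * (q - r) := star_mul_self_nonneg _
  calc star (q + r) * (q + r)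
      ≤ star (q + r) * (q + r) + star (q - r) * (q - r) := le_add_of_nonneg_right h2
    _ = (star q * q + star r * r) + (star q * q + star r * r) := by
        rw [star_add, star_sub]; noncomm_ring
    _ ≤ _ := by gcongr

theorem mul_of_commute {f : SmoothMap I M ℂ} (hf : f p = 0) {b : Q} (hb : Commute b (π f)) :
    VanishesAt π p (π f * b) := by
  have hk : ContMDiff I 𝓘(ℝ) ∞ fun m => ‖b‖ ^ 2 * ‖f m‖ ^ 2 :=
    contMDiff_const.mul ((contDiff_norm_sq ℝ).comp_contMDiff f.contMDiff)
  refine ⟨_, hk, by simp [hf], ?_⟩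
  have h1 : SmoothMap.ofReal _ hk = ((‖b‖ ^ 2 : ℝ) : ℂ) • (star f * f) := by
    ext m
    simp only [ofReal_apply, smul_apply, mul_apply, star_apply, smul_eq_mul, Complex.star_def,
      Complex.conj_mul']
    push_cast
    ring
  have h2 := CStarAlgebra.star_left_conjugate_le_norm_smul (a := π f) (b := star b * b)
    (IsSelfAdjoint.star_mul_self b)
  rw [h1, map_smul, map_mul, map_star, ← hb.eq, star_mul]
  rw [CStarRing.norm_star_mul_self, ← pow_two] at h2
  calc star (π f) * star b * (b * π f) = star (π f) * (star b * b) * π f := by noncomm_ring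
    _ ≤ _ := h2
    _ = _ := (Complex.coe_smul _ _).symm

/-- A unital `*`-homomorphism on `C^∞(M)` is positive. -/
theorem _root_.SmoothMap.map_nonneg (π : SmoothMap I M ℂ →⋆ₐ[ℂ] Q) {k : M → ℝ}
    (hk : ContMDiff I 𝓘(ℝ) ∞ k) (h0 : ∀ m, 0 ≤ k m) : 0 ≤ π (.ofReal k hk) := by
  have hpos : ∀ δ : ℝ, 0 < δ → 0 ≤ π (.ofReal k hk) + algebraMap ℂ Q δ := by
    intro δ hδ
    have hs : ContMDiff I 𝓘(ℝ) ∞ fun m => Real.sqrt (k m + δ) := fun m =>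
      (Real.contDiffAt_sqrt (by linarith [h0 m] : k m + δ ≠ 0)).contMDiffAt.comp m
        ((hk m).add contMDiffAt_const)
    have : SmoothMap.ofReal k hk + algebraMap ℂ _ (δ : ℂ) =
        star (SmoothMap.ofReal _ hs) * SmoothMap.ofReal _ hs := by
      ext m
      change (k m : ℂ) + δ = star (Real.sqrt (k m + δ) : ℂ) * (Real.sqrt (k m + δ) : ℂ)
      rw [Complex.star_def, Complex.conj_ofReal, ← Complex.ofReal_mul,
        Real.mul_self_sqrt (by linarith [h0 m]), Complex.ofReal_add]
    have h := congrArg π this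
    rw [map_add, map_mul, map_star, AlgHomClass.commutes] at h
    rw [h]
    exact star_mul_self_nonneg _
  have hlim : Filter.Tendsto (fun δ : ℝ => π (.ofReal k hk) + algebraMap ℂ Q δ) (𝓝[>] 0)
      (𝓝 (π (.ofReal k hk))) := by
    have : Continuous fun δ : ℝ => π (.ofReal k hk) + algebraMap ℂ Q (δ : ℂ) := by fun_prop
    simpa using (this.tendsto 0).mono_left nhdsWithin_le_nhds
  exact ge_of_tendsto hlim (Filter.eventually_of_mem self_mem_nhdsWithin hpos)

variable [IsManifold I ∞ M] [FiniteDimensional ℝ E] [T2Space M] [CompactSpace M]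

/-- An element that commutes with the range of `π` and vanishes at every point is zero. -/
theorem eq_zero {q : Q} (hc : ∀ f, Commute q (π f)) (hq : ∀ p, VanishesAt π p q) : q = 0 := by
  choose k hk hkp hle using hq
  have hT : ∀ f, Commute (star q * q) (π f) := fun f => by
    refine Commute.mul_left ?_ (hc f)
    have := (hc (star f)).star_star
    rwa [map_star, star_star] at this
  have key : ∀ ε : ℝ, 0 < ε → star q * q ≤ algebraMap ℂ Q ε := by
    intro ε hε
    have hopen : ∀ p, IsOpen {m | k p m < ε} := fun p =>
      isOpen_lt (hk p).continuous continuous_const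
    obtain ⟨t, ht⟩ := isCompact_univ.elim_finite_subcover (fun p => {m | k p m < ε}) hopen
      fun m _ => Set.mem_iUnion.2 ⟨m, by simpa [hkp] using hε⟩
    obtain ⟨ρ, hρ⟩ := SmoothPartitionOfUnity.exists_isSubordinate I isClosed_univ
      (fun p : t => {m | k p m < ε}) (fun p => hopen p) (by
        intro m hm
        obtain ⟨p, hp, hmp⟩ := Set.mem_iUnion₂.1 (ht hm)
        exact Set.mem_iUnion.2 ⟨⟨p, hp⟩, hmp⟩)
    have hsum : ∀ m, ∑ i, ρ i m = 1 := fun m => by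
      rw [← finsum_eq_sum_of_fintype]; exact ρ.sum_eq_one (Set.mem_univ m)
    let R : t → SmoothMap I M ℂ := fun i => .ofReal (ρ i) (ρ i).contMDiff
    have hR1 : ∑ i, R i = 1 := by
      ext m
      rw [sum_apply, one_apply, ← Complex.ofReal_one, ← hsum m, Complex.ofReal_sum]
      rfl
    have hone : ∀ i, 0 ≤ π (R i) * (algebraMap ℂ Q ε - star q * q) := by
      intro i
      have h1 : 0 ≤ π (R i) * (π (.ofReal (k i) (hk i)) - star q * q) :=
        Commute.mul_nonneg (SmoothMap.map_nonneg π _ fun m => ρ.nonneg i m)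
          (sub_nonneg.2 (hle i)) (Commute.sub_right
            (by rw [commute_iff_eq, ← map_mul, ← map_mul, mul_comm_complex]) (hT _).symm)
      have hs : ContMDiff I 𝓘(ℝ) ∞ fun m => ρ i m * (ε - k i m) :=
        (ρ i).contMDiff.mul (contMDiff_const.sub (hk i))
      have h2 : 0 ≤ π (.ofReal _ hs) := SmoothMap.map_nonneg π hs fun m => by
        by_cases hm : m ∈ tsupport (ρ i)
        · exact mul_nonneg (ρ.nonneg i m) (sub_nonneg.2 (hρ i hm).le)
        · simp [image_eq_zero_of_notMem_tsupport hm]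
      have h3 : SmoothMap.ofReal _ hs = R i * (algebraMap ℂ _ (ε : ℂ) - .ofReal (k i) (hk i)) := by
        ext m
        change ((ρ i m * (ε - k i m) : ℝ) : ℂ) = (ρ i m : ℂ) * ((ε : ℂ) - k i m)
        push_cast; ring
      rw [h3, map_mul, map_sub, AlgHomClass.commutes] at h2
      calc 0 ≤ _ := add_nonneg h1 h2
        _ = _ := by rw [← mul_add]; congr 1; abel
    have := Finset.sum_nonneg fun i (_ : i ∈ Finset.univ) => hone i
    rw [← Finset.sum_mul, ← map_sum, hR1, map_one, one_mul] at this
    exact sub_nonneg.1 this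
  have hle0 : star q * q ≤ 0 := by
    have hlim : Filter.Tendsto (fun δ : ℝ => algebraMap ℂ Q δ) (𝓝[>] 0) (𝓝 0) := by
      have : Continuous fun δ : ℝ => algebraMap ℂ Q (δ : ℂ) := by fun_prop
      simpa using (this.tendsto 0).mono_left nhdsWithin_le_nhds
    exact ge_of_tendsto hlim (Filter.eventually_of_mem self_mem_nhdsWithin key)
  have := le_antisymm hle0 (star_mul_self_nonneg q)
  exact CStarRing.star_mul_self_eq_zero_iff q |>.1 this

end SmoothMap.VanishesAt

end Order

variable [IsManifold I ∞ M] [FiniteDimensional ℝ E] [T2Space M] [CompactSpace M]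

/-- A derivation `D` of `C^∞(M)` along a `*`-homomorphism `π` into a C*-algebra, with values in the
commutant of `π`, factors through one-forms: relations between differentials are respected. -/
theorem SmoothMap.sum_mul_derivation_eq_zero (π : SmoothMap I M ℂ →⋆ₐ[ℂ] Q)
    (D : SmoothMap I M ℂ →ₗ[ℂ] Q) (hD : ∀ f g, D (f * g) = π f * D g + D f * π g)
    (hc : ∀ f g, Commute (D f) (π g)) {ι : Type*} (s : Finset ι) (f g : ι → SmoothMap I M ℂ)
    (h : ∀ (m : M) (v : TangentSpace I m), ∑ i ∈ s, f i m * derivAt m v (g i) = 0) :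
    ∑ i ∈ s, π (f i) * D (g i) = 0 := by
  let _ := CStarAlgebra.spectralOrder Q
  have := CStarAlgebra.spectralOrderedRing Q
  have hπ : ∀ f g, Commute (π f) (π g) := fun f g => by
    rw [commute_iff_eq, ← map_mul, ← map_mul, mul_comm_complex]
  refine VanishesAt.eq_zero (π := π)
    (fun a => Commute.sum_left _ _ _ fun i _ => (hπ _ _).mul_left (hc _ _)) fun p => ?_
  have hD1 : D 1 = 0 := by simpa using hD 1 1
  let G : SmoothMap I M ℂ := ∑ i ∈ s, f i p • (g i - algebraMap ℂ _ (g i p))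
  have hsplit : ∑ i ∈ s, π (f i) * D (g i) =
      ∑ i ∈ s, π (f i - algebraMap ℂ _ (f i p)) * D (g i) + D G := by
    rw [map_sum, ← Finset.sum_add_distrib]
    refine Finset.sum_congr rfl fun i _ => ?_
    rw [map_sub, AlgHomClass.commutes, map_smul, map_sub, Algebra.algebraMap_eq_smul_one (g i p),
      map_smul, hD1, smul_zero, sub_zero, sub_mul, ← Algebra.smul_def, sub_add_cancel]
  rw [hsplit]
  refine VanishesAt.add (Finset.sum_induction _ (VanishesAt π p)
    (fun _ _ => VanishesAt.add) VanishesAt.zero fun i _ =>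
      VanishesAt.mul_of_commute (sub_self (f i p)) (hc _ _)) ?_
  have hG0 : G p = 0 := by
    rw [sum_apply]
    refine Finset.sum_eq_zero fun i _ => ?_
    change f i p * (g i p - g i p) = 0
    simp
  have hG1 : mfderiv I 𝓘(ℝ, ℂ) G p = 0 := by
    refine ContinuousLinearMap.ext fun v => (?_ : derivAt p v G = 0)
    rw [map_sum, ← h p v]
    refine Finset.sum_congr rfl fun i _ => ?_
    rw [map_smul, map_sub, derivAt_algebraMap, sub_zero, smul_eq_mul]
  refine AddSubmonoid.closure_induction (motive := fun a _ => VanishesAt π p (D a)) ?_ ?_ ?_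
    (G.mem_closure_vanishingProducts p hG0 hG1)
  · rintro _ ⟨a, b, ha, hb, rfl⟩
    rw [hD, (hc a b).eq]
    exact (VanishesAt.mul_of_commute ha (hc _ _)).add (VanishesAt.mul_of_commute hb (hc _ _))
  · rw [map_zero]; exact VanishesAt.zero
  · intro a b _ _ ha hb
    rw [map_add]; exact ha.add hb

end Key

section VectorFields

variable {E : Type*} [NormedAddCommGroup E] [NormedSpace ℝ E]
  {H : Type*} [TopologicalSpace H] {I : ModelWithCorners ℝ E H}
  {M : Type*} [TopologicalSpace M] [ChartedSpace H M] [IsManifold I ∞ M]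

/-- The vector field that is constant, with value `w`, in the chart at `c`, cut off by `ψ`. -/
def cutoffField (c : M) (ψ : M → ℝ) (hψ : ContMDiff I 𝓘(ℝ) ∞ ψ)
    (hs : tsupport ψ ⊆ (chartAt H c).source) (w : E) :
    Cₛ^∞⟮I; E, (TangentSpace I : M → Type _)⟯ where
  toFun := ψ • fun m => (trivializationAt E (TangentSpace I) c).symmL ℝ m w
  contMDiff_toFun := by
    refine ContMDiffOn.smul_section_of_tsupport (u := (chartAt H c).source) hψ.contMDiffOn
      (chartAt H c).open_source hs ?_
    rw [← TangentBundle.trivializationAt_baseSet (I := I)]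
    rw [Bundle.Trivialization.contMDiffOn_section_baseSet_iff]
    refine (contMDiffOn_const (c := w)).congr fun m hm => ?_
    rw [Bundle.Trivialization.symmL_apply _ hm]
    exact congrArg Prod.snd ((trivializationAt E (TangentSpace I) c).apply_mk_symm hm w)

theorem cutoffField_apply (c : M) (ψ : M → ℝ) (hψ : ContMDiff I 𝓘(ℝ) ∞ ψ)
    (hs : tsupport ψ ⊆ (chartAt H c).source) (w : E) (m : M) :
    cutoffField c ψ hψ hs w m = ψ m • (trivializationAt E (TangentSpace I) c).symmL ℝ m w := rfl

/-- The coordinate expression of a smooth vector field in the chart at `c`. -/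
def fieldInChart (X : Cₛ^∞⟮I; E, (TangentSpace I : M → Type _)⟯) (c : M) (y : E) : E :=
  (trivializationAt E (TangentSpace I) c
    ⟨(extChartAt I c).symm y, X ((extChartAt I c).symm y)⟩).2

theorem contDiffOn_fieldInChart (X : Cₛ^∞⟮I; E, (TangentSpace I : M → Type _)⟯) (c : M) :
    ContDiffOn ℝ ∞ (fieldInChart X c) (extChartAt I c).target := by
  have h1 := (Bundle.Trivialization.contMDiffOn_section_baseSet_iff
    (trivializationAt E (TangentSpace I) c)).1 (X.contMDiff_toFun.contMDiffOn)
  refine contMDiffOn_iff_contDiffOn.1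
    (h1.comp (contMDiffOn_extChartAt_symm c) fun y hy => ?_)
  rw [Set.mem_preimage, TangentBundle.trivializationAt_baseSet, ← extChartAt_source I]
  exact (extChartAt I c).map_target hy

theorem formInChart_fieldInChart {A : Type u} [CStarAlgebra A]
    (θ : ∀ m : M, TangentSpace I m →L[ℝ] A) (X : Cₛ^∞⟮I; E, (TangentSpace I : M → Type _)⟯)
    (c : M) {y : E} (hy : y ∈ (extChartAt I c).target) :
    formInChart I θ c y (fieldInChart X c y) =
      θ ((extChartAt I c).symm y) (X ((extChartAt I c).symm y)) := by
  have hm : (extChartAt I c).symm y ∈ (chartAt H c).source := by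
    rw [← extChartAt_source I]; exact (extChartAt I c).map_target hy
  have h1 : fieldInChart X c y = mfderiv I 𝓘(ℝ, E) (extChartAt I c) ((extChartAt I c).symm y)
      (X ((extChartAt I c).symm y)) := by
    rw [← TangentBundle.continuousLinearMapAt_trivializationAt hm]
    refine Eq.trans ?_ (congrFun (Bundle.Trivialization.continuousLinearMapAt_apply ℝ _ _) _).symm
    rw [Bundle.Trivialization.coe_linearMapAt_of_mem _ hm]
    rfl
  have h2 := mfderivWithin_extChartAt_symm_comp_mfderiv_extChartAt (I := I) hy
  have h3 := congrArg (fun L => L (X ((extChartAt I c).symm y))) h2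
  rw [h1]
  exact congrArg (θ ((extChartAt I c).symm y)) h3

theorem exists_field_eq [FiniteDimensional ℝ E] [T2Space M] (m : M) (v : TangentSpace I m) :
    ∃ X : Cₛ^∞⟮I; E, (TangentSpace I : M → Type _)⟯, X m = v := by
  let σ : SmoothBumpFunction I m := Classical.arbitrary _
  refine ⟨cutoffField m σ σ.contMDiff σ.tsupport_subset_chartAt_source
    ((trivializationAt E (TangentSpace I) m).continuousLinearMapAt ℝ m v), ?_⟩
  rw [cutoffField_apply, σ.eq_one, one_smul]
  exact Bundle.Trivialization.symmL_continuousLinearMapAt _ (mem_chart_source H m) v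

variable (I M) in
/-- There are finitely many smooth vector fields `X i` and functions `h i` such that
`η = ∑ i, η(X i) d(h i)` for every one-form `η`. -/
theorem exists_finite_coframe [FiniteDimensional ℝ E] [T2Space M] [CompactSpace M] :
    ∃ (n : ℕ) (X : Fin n → Cₛ^∞⟮I; E, (TangentSpace I : M → Type _)⟯)
      (h : Fin n → SmoothMap I M ℂ), ∀ (m : M) (η : TangentSpace I m →L[ℝ] ℂ)
      (v : TangentSpace I m), ∑ i, η (X i m) * SmoothMap.derivAt m v (h i) = η v := by
  suffices H : ∃ (ι : Type _) (_ : Fintype ι) (X : ι → Cₛ^∞⟮I; E, (TangentSpace I : M → Type _)⟯)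
      (h : ι → SmoothMap I M ℂ), ∀ (m : M) (η : TangentSpace I m →L[ℝ] ℂ)
      (v : TangentSpace I m), ∑ i, η (X i m) * SmoothMap.derivAt m v (h i) = η v by
    obtain ⟨ι, _, X, h, H⟩ := H
    let e := (Fintype.equivFin ι).symm
    exact ⟨_, X ∘ e, h ∘ e, fun m η v => (e.sum_comp
      (fun i => η (X i m) * SmoothMap.derivAt m v (h i))).trans (H m η v)⟩
  let σ : ∀ c : M, SmoothBumpFunction I c := fun c => Classical.arbitrary _
  let U : M → Set M := fun c => {m | σ c =ᶠ[𝓝 m] 1} ∩ (chartAt H c).source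
  have hopen : ∀ c, IsOpen (U c) := fun c =>
    isOpen_setOfPred_eventually_nhds.inter (chartAt H c).open_source
  obtain ⟨t, ht⟩ := isCompact_univ.elim_finite_subcover U hopen
    fun m _ => Set.mem_iUnion.2 ⟨m, (σ m).eventuallyEq_one, mem_chart_source H m⟩
  obtain ⟨ρ, hρ⟩ := SmoothPartitionOfUnity.exists_isSubordinate I isClosed_univ
    (fun c : t => U c) (fun c => hopen c) (by
      intro m hm
      obtain ⟨c, hc, hmc⟩ := Set.mem_iUnion₂.1 (ht hm)
      exact Set.mem_iUnion.2 ⟨⟨c, hc⟩, hmc⟩)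
  have hsum : ∀ m, ∑ c, ρ c m = 1 := fun m => by
    rw [← finsum_eq_sum_of_fintype]; exact ρ.sum_eq_one (Set.mem_univ m)
  let b := Module.finBasis ℝ E
  let X : t × Fin (Module.finrank ℝ E) → Cₛ^∞⟮I; E, (TangentSpace I : M → Type _)⟯ := fun i =>
    cutoffField i.1.1 (ρ i.1) (ρ i.1).contMDiff ((hρ i.1).trans Set.inter_subset_right) (b i.2)
  have hcoord : ∀ (c : M) (j : Fin (Module.finrank ℝ E)), ContMDiff I 𝓘(ℝ) ∞
      fun m => σ c m • b.equivFunL (extChartAt I c m) j := fun c j =>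
    (σ c).contMDiff_smul (g := fun m => b.equivFunL (extChartAt I c m) j)
      (((contDiff_apply ℝ ℝ j (n := ∞)).comp b.equivFunL.contDiff).contMDiff.comp_contMDiffOn
        contMDiffOn_extChartAt)
  refine ⟨_, inferInstance, X, fun i => .ofReal _ (hcoord i.1 i.2), fun m η v => ?_⟩
  have hone : ∀ c : t, ∑ j, η (X (c, j) m) * SmoothMap.derivAt m v (.ofReal _ (hcoord c j)) =
      ρ c m * η v := by
    intro c
    by_cases hm : m ∈ tsupport (ρ c)
    swap
    · have hz : ρ c m = 0 := image_eq_zero_of_notMem_tsupport hm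
      have hX : ∀ j, X (c, j) m = 0 := fun j => by
        change cutoffField _ _ _ _ _ m = 0
        rw [cutoffField_apply, hz, zero_smul]
      simp [hX, hz]
    obtain ⟨hm1, hm2⟩ := hρ c hm
    set L := (trivializationAt E (TangentSpace I) c.1).continuousLinearMapAt ℝ m with hL
    have hd : ∀ j, SmoothMap.derivAt m v (.ofReal _ (hcoord c j)) =
        ((b.equivFunL (L v) j : ℝ) : ℂ) := by
      intro j
      let C : E →L[ℝ] ℂ := Complex.ofRealCLM ∘L (ContinuousLinearMap.proj j) ∘L
        (b.equivFunL : E →L[ℝ] (Fin (Module.finrank ℝ E) → ℝ))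
      have h1 := (C.hasMFDerivAt (x := extChartAt I c.1 m)).comp m
        (mdifferentiableAt_extChartAt hm2).hasMFDerivAt
      have h2 : (fun m => ((σ c.1 m • b.equivFunL (extChartAt I c.1 m) j : ℝ) : ℂ)) =ᶠ[𝓝 m]
          C ∘ extChartAt I c.1 := by
        filter_upwards [hm1] with z hz
        rw [hz]
        simp [C]
      have h3 := (h1.congr_of_eventuallyEq h2).mfderiv
      rw [hL, TangentBundle.continuousLinearMapAt_trivializationAt hm2]
      exact congrArg (fun L : TangentSpace I m →L[ℝ] ℂ => L v) h3
    have hv : v = ∑ j, b.equivFunL (L v) j •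
        (trivializationAt E (TangentSpace I) c.1).symmL ℝ m (b j) := by
      have h1 := Bundle.Trivialization.symmL_continuousLinearMapAt (R := ℝ)
        (trivializationAt E (TangentSpace I) c.1) hm2 v
      conv_lhs => rw [← h1, ← hL, ← b.sum_equivFun (L v), map_sum]
      exact Finset.sum_congr rfl fun j _ => map_smul _ _ _
    conv_rhs => rw [hv, map_sum, Finset.mul_sum]
    refine Finset.sum_congr rfl fun j _ => ?_
    rw [hd]
    change η (cutoffField _ _ _ _ _ m) * _ = _
    rw [cutoffField_apply, map_smul, map_smul, Complex.real_smul, Complex.real_smul]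
    ring
  rw [Fintype.sum_prod_type]
  simp_rw [hone]
  rw [← Finset.sum_mul, ← Complex.ofReal_sum, hsum, Complex.ofReal_one, one_mul]

end VectorFields

section Continuity

theorem WithSeminorms.continuous_of_le_sum {X Y ι κ : Type*} [AddCommGroup X] [Module ℂ X]
    [TopologicalSpace X] [AddCommGroup Y] [Module ℂ Y] [TopologicalSpace Y]
    {p : SeminormFamily ℂ X ι} {q : SeminormFamily ℂ Y κ} (hp : WithSeminorms p)
    (hq : WithSeminorms q) (T : X →ₗ[ℂ] Y)
    (h : ∀ i, ∃ (C : ℝ) (n : ℕ) (σ : ℕ → ι), 0 ≤ C ∧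
      ∀ x, q i (T x) ≤ C * ∑ j ∈ Finset.range n, p (σ j) x) : Continuous T := by
  have := hp.topologicalAddGroup
  refine WithSeminorms.continuous_of_continuous_comp hq T fun i => ?_
  obtain ⟨C, n, σ, hC, hle⟩ := h i
  let r : Seminorm ℂ X := C.toNNReal • ∑ j ∈ Finset.range n, p (σ j)
  have hr : ∀ x, r x = C * ∑ j ∈ Finset.range n, p (σ j) x := fun x => by
    rw [smul_apply, sum_apply, NNReal.smul_def, Real.coe_toNNReal _ hC, smul_eq_mul]
  refine Seminorm.continuous_of_le (q := r) ?_ fun x => (hle x).trans (hr x).ge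
  rw [show (r : X → ℝ) = _ from funext hr]
  exact continuous_const.mul (continuous_finsetSum _ fun j _ => hp.continuous_seminorm (σ j))

variable {E : Type*} [NormedAddCommGroup E] [NormedSpace ℝ E]
  {H : Type*} [TopologicalSpace H] {I : ModelWithCorners ℝ E H}
  {M : Type*} [TopologicalSpace M] [ChartedSpace H M]

/-- The same chart and compact set, with another order of differentiation. -/
def ChartIndex.withOrder (i : ChartIndex (M := M) I) (k : ℕ) : ChartIndex (M := M) I :=
  { i with k := k }

theorem ChartIndex.supDeriv_congr {W : Type*} [NormedAddCommGroup W] [NormedSpace ℂ W]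
    (i : ChartIndex (M := M) I) {f g : E → W} (h : Set.EqOn f g (extChartAt I i.c).target) :
    i.supDeriv f = i.supDeriv g :=
  iSup_congr fun y => by rw [iteratedFDerivWithin_congr h (i.subset y.2)]

theorem ChartIndex.exists_supDeriv_bilinear_le {V W Z : Type*} [NormedAddCommGroup V]
    [NormedSpace ℝ V] [NormedAddCommGroup W] [NormedSpace ℂ W] [NormedAddCommGroup Z]
    [NormedSpace ℂ Z] (i : ChartIndex (M := M) I) (B : W →L[ℝ] V →L[ℝ] Z) {g : E → V}
    (hg : ContDiffOn ℝ ∞ g (extChartAt I i.c).target) :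
    ∃ C : ℝ, 0 ≤ C ∧ ∀ f : E → W, ContDiffOn ℝ ∞ f (extChartAt I i.c).target →
      i.supDeriv (fun y => B (f y) (g y)) ≤
        C * ∑ j ∈ Finset.range (i.k + 1), (i.withOrder j).supDeriv f := by
  have hu := uniqueDiffOn_extChartAt_target (I := I) i.c
  have hb : ∀ j : ℕ, ∃ C : ℝ, ∀ y ∈ i.K,
      ‖iteratedFDerivWithin ℝ j g (extChartAt I i.c).target y‖ ≤ C := fun j =>
    i.isCompact.exists_bound_of_continuousOn
      ((hg.continuousOn_iteratedFDerivWithin (by exact_mod_cast le_top) hu).mono i.subset)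
  choose c hc using hb
  let a : ℕ → ℝ := fun j => ‖B‖ * ((i.k.choose j : ℝ) * |c (i.k - j)|)
  have ha : ∀ j, 0 ≤ a j := fun j => by positivity
  refine ⟨∑ j ∈ Finset.range (i.k + 1), a j, Finset.sum_nonneg fun j _ => ha j, fun f hf => ?_⟩
  have hpos : ∀ j, 0 ≤ (i.withOrder j).supDeriv f := fun j => (i.withOrder j).supDeriv_nonneg f
  refine Real.iSup_le (fun y => ?_) (mul_nonneg (Finset.sum_nonneg fun j _ => ha j)
    (Finset.sum_nonneg fun j _ => hpos j))
  refine (B.norm_iteratedFDerivWithin_le_of_bilinear hf hg hu (i.subset y.2)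
    (by exact_mod_cast le_top)).trans ?_
  rw [Finset.mul_sum, Finset.sum_mul]
  refine Finset.sum_le_sum fun j hj => ?_
  have h1 : ‖iteratedFDerivWithin ℝ j f (extChartAt I i.c).target y‖ ≤
      ∑ j ∈ Finset.range (i.k + 1), (i.withOrder j).supDeriv f :=
    (le_ciSup ((i.withOrder j).bddAbove hf) y).trans
      (Finset.single_le_sum (f := fun j => (i.withOrder j).supDeriv f) (fun j _ => hpos j) hj)
  have h2 := (hc (i.k - j) y y.2).trans (le_abs_self _)
  calc _ ≤ ‖B‖ * ((i.k.choose j : ℝ) * (∑ j ∈ Finset.range (i.k + 1),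
          (i.withOrder j).supDeriv f) * |c (i.k - j)|) := by
        have := Finset.sum_nonneg fun j (_ : j ∈ Finset.range (i.k + 1)) => hpos j
        gcongr
    _ = _ := by simp only [a]; ring

variable {A : Type u} [CStarAlgebra A]

instance : IsTopologicalAddGroup (OneForm I M A) :=
  topologicalAddGroup_iInf fun i =>
    (OneForm.seminorm i).toSeminormedAddCommGroup.toIsTopologicalAddGroup

theorem OneForm.withSeminorms :
    WithSeminorms (fun i : ChartIndex (M := M) I => OneForm.seminorm (A := A) i) :=
  (SeminormFamily.withSeminorms_iff_topologicalSpace_eq_iInf _).2 rfl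

variable [IsManifold I ∞ M]

instance : IsTopologicalAddGroup (SmoothMap I M A) :=
  topologicalAddGroup_iInf fun i =>
    (SmoothMap.seminorm i).toSeminormedAddCommGroup.toIsTopologicalAddGroup

theorem SmoothMap.withSeminorms :
    WithSeminorms (fun i : ChartIndex (M := M) I => SmoothMap.seminorm (A := A) i) :=
  (SeminormFamily.withSeminorms_iff_topologicalSpace_eq_iInf _).2 rfl

/-- The contraction `θ ↦ θ(X)` of one-forms with a smooth vector field. -/
def OneForm.contract (X : Cₛ^∞⟮I; E, (TangentSpace I : M → Type _)⟯) :
    OneForm I M A →ₗ[ℂ] SmoothMap I M A where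
  toFun θ := ⟨fun m => θ m (X m), fun m => by
    have h1 : ContDiffOn ℝ ∞ (fun y => formInChart I θ m y (fieldInChart X m y))
        (extChartAt I m).target :=
      (θ.contDiffOn_inChart m).clm_apply (contDiffOn_fieldInChart X m)
    have h2 := h1.contMDiffOn.comp (contMDiffOn_extChartAt (I := I) (x := m) (n := ∞)) fun z hz =>
      (extChartAt I m).map_source (by rwa [extChartAt_source])
    refine ((h2.congr fun z hz => ?_).contMDiffAt
      ((chartAt H m).open_source.mem_nhds (mem_chart_source H m)))
    rw [← extChartAt_source I] at hz
    have h3 := formInChart_fieldInChart (I := I) θ.1 X m ((extChartAt I m).map_source hz)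
    rw [(extChartAt I m).left_inv hz] at h3
    exact h3.symm⟩
  map_add' _ _ := rfl
  map_smul' _ _ := rfl

theorem OneForm.continuous_contract (X : Cₛ^∞⟮I; E, (TangentSpace I : M → Type _)⟯) :
    Continuous (OneForm.contract (A := A) X) := by
  refine OneForm.withSeminorms.continuous_of_le_sum SmoothMap.withSeminorms _ fun i => ?_
  let B : (E →L[ℝ] A) →L[ℝ] E →L[ℝ] A := ContinuousLinearMap.id ℝ (E →L[ℝ] A)
  obtain ⟨C, hC, h⟩ := i.exists_supDeriv_bilinear_le B (contDiffOn_fieldInChart X i.c)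
  refine ⟨C, i.k + 1, i.withOrder, hC, fun θ => ?_⟩
  have h1 : i.supDeriv ((OneForm.contract X θ).inChart i.c) =
      i.supDeriv (fun y => B (formInChart I θ i.c y) (fieldInChart X i.c y)) :=
    i.supDeriv_congr fun y hy => (formInChart_fieldInChart θ.1 X i.c hy).symm
  have h2 := h _ (θ.contDiffOn_inChart i.c)
  rw [← h1] at h2
  exact h2

/-- Left multiplication `F ↦ F θ` of a fixed form, as a linear map. -/
def OneForm.lmulₗ (θ : OneForm I M A) : SmoothMap I M A →ₗ[ℂ] OneForm I M A where
  toFun F := OneForm.lmul F θ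
  map_add' F G := Subtype.ext (funext fun m => ContinuousLinearMap.ext fun v =>
    add_mul (F m) (G m) (θ m v))
  map_smul' c F := Subtype.ext (funext fun m => ContinuousLinearMap.ext fun v =>
    smul_mul_assoc c (F m) (θ m v))

theorem OneForm.continuous_lmulₗ (θ : OneForm I M A) : Continuous θ.lmulₗ := by
  refine SmoothMap.withSeminorms.continuous_of_le_sum OneForm.withSeminorms _ fun i => ?_
  obtain ⟨C, hC, h⟩ := i.exists_supDeriv_bilinear_le (W := A) (Z := E →L[ℝ] A)
    ((ContinuousLinearMap.compL ℝ E A A).comp (ContinuousLinearMap.mul ℝ A))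
    (θ.contDiffOn_inChart i.c)
  exact ⟨C, i.k + 1, i.withOrder, hC, fun F => h _ (F.contDiffOn_inChart i.c)⟩

end Continuity

section Lift

variable {E : Type*} [NormedAddCommGroup E] [NormedSpace ℝ E]
  {H : Type*} [TopologicalSpace H] {I : ModelWithCorners ℝ E H}
  {M : Type*} [TopologicalSpace M] [ChartedSpace H M] {A : Type u} [CStarAlgebra A]

theorem OneForm.ext {θ η : OneForm I M A} (h : ∀ m (v : TangentSpace I m), θ m v = η m v) :
    θ = η :=
  Subtype.ext (funext fun m => ContinuousLinearMap.ext (h m))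

/-- Evaluation of a one-form on a tangent vector. -/
def OneForm.evalAt (m : M) (v : TangentSpace I m) : OneForm I M A →+ A where
  toFun θ := θ m v
  map_zero' := rfl
  map_add' _ _ := rfl

variable [IsManifold I ∞ M]

/-- The map `θ ↦ ∑ i, α(θ(X i)) d α(h i)` on one-forms. -/
def OneForm.liftAlong {B : Type v} [CStarAlgebra B] (α : SmoothMap I M A →ₗ[ℂ] SmoothMap I M B)
    (hα : Continuous α) {n : ℕ} (X : Fin n → Cₛ^∞⟮I; E, (TangentSpace I : M → Type _)⟯)
    (h : Fin n → SmoothMap I M A) : OneForm I M A →L[ℂ] OneForm I M B where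
  toLinearMap := ∑ i, (α (h i)).d.lmulₗ ∘ₗ α ∘ₗ OneForm.contract (X i)
  cont := by
    rw [show ((∑ i, (α (h i)).d.lmulₗ ∘ₗ α ∘ₗ OneForm.contract (X i) :
      OneForm I M A →ₗ[ℂ] OneForm I M B)).toFun = fun θ => ∑ i,
        (α (h i)).d.lmulₗ (α (OneForm.contract (X i) θ)) from
      funext fun θ => LinearMap.sum_apply _ _ _]
    exact continuous_finsetSum _ fun i _ => (OneForm.continuous_lmulₗ _).comp
      (hα.comp (OneForm.continuous_contract (X i)))

theorem OneForm.liftAlong_apply {B : Type v} [CStarAlgebra B]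
    (α : SmoothMap I M A →ₗ[ℂ] SmoothMap I M B) (hα : Continuous α) {n : ℕ}
    (X : Fin n → Cₛ^∞⟮I; E, (TangentSpace I : M → Type _)⟯) (h : Fin n → SmoothMap I M A)
    (θ : OneForm I M A) (m : M) (v : TangentSpace I m) :
    OneForm.liftAlong α hα X h θ m v =
      ∑ i, α (OneForm.contract (X i) θ) m * SmoothMap.derivAt m v (α (h i)) := by
  change OneForm.evalAt m v ((∑ i, (α (h i)).d.lmulₗ ∘ₗ α ∘ₗ OneForm.contract (X i)) θ) = _
  rw [LinearMap.sum_apply, map_sum]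
  rfl

end Lift

end

theorem mainTheorem2
    {E : Type*} [NormedAddCommGroup E] [NormedSpace ℝ E] [FiniteDimensional ℝ E]
    {H : Type*} [TopologicalSpace H] (I : ModelWithCorners ℝ E H)
    (M : Type*) [TopologicalSpace M] [ChartedSpace H M] [IsManifold I ∞ M]
    [T2Space M] [CompactSpace M]
    {Q : Type u} [CStarAlgebra Q] (G : CompactQuantumGroup Q) (α : SmoothAction I M G) :
    (∃ β : OneForm I M ℂ →L[ℂ] OneForm I M Q,
      (∀ (f : SmoothMap I M ℂ) (θ : OneForm I M ℂ), β (.lmul f θ) = .lmul (α f) (β θ)) ∧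
      (∀ (f : SmoothMap I M ℂ) (θ : OneForm I M ℂ), β (.rmul θ f) = .rmul (β θ) (α f)) ∧
      ∀ f : SmoothMap I M ℂ, β f.d = (α f).d) ↔
    ∀ (f g : SmoothMap I M ℂ) (ν : Cₛ^∞⟮I; E, (TangentSpace I : M → Type _)⟯),
      SmoothMap.along ν (α f) * ⇑(α g) = ⇑(α g) * SmoothMap.along ν (α f) := by
  have hlr : ∀ (f : SmoothMap I M ℂ) (θ : OneForm I M ℂ), OneForm.rmul θ f = .lmul f θ :=
    fun f θ => OneForm.ext fun m v => mul_comm (θ m v) (f m)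
  constructor
  · rintro ⟨β, hl, hr, hd⟩ f g ν
    have h : OneForm.rmul (α f).d (α g) = .lmul (α g) (α f).d := by
      rw [← hd, ← hr, ← hl, hlr]
    funext m
    exact congrArg (OneForm.evalAt m (ν m)) h
  · intro hcomm
    have hc : ∀ (m : M) (v : TangentSpace I m) (f g : SmoothMap I M ℂ),
        Commute (SmoothMap.derivAt m v (α f)) (α g m) := by
      intro m v f g
      obtain ⟨X, rfl⟩ := exists_field_eq m v
      exact congrFun (hcomm f g X) m
    obtain ⟨n, X, h, hX⟩ := exists_finite_coframe I M
    have hα : ∀ f g (m : M), α (f * g) m = α f m * α g m := fun f g m =>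
      congrArg (SmoothMap.eval m) (map_mul α.toHom f g)
    let β := OneForm.liftAlong α.toHom.toAlgHom.toLinearMap α.continuous X h
    have hβ : ∀ θ m v, β θ m v =
        ∑ i, α (OneForm.contract (X i) θ) m * SmoothMap.derivAt m v (α (h i)) :=
      OneForm.liftAlong_apply _ _ X h
    have hleft : ∀ (f : SmoothMap I M ℂ) (θ : OneForm I M ℂ),
        β (.lmul f θ) = .lmul (α f) (β θ) := by
      intro f θ
      refine OneForm.ext fun m v => ?_
      rw [OneForm.lmul_apply, hβ, hβ, Finset.mul_sum]
      refine Finset.sum_congr rfl fun i _ => ?_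
      rw [← mul_assoc, ← hα]
      rfl
    refine ⟨β, hleft, fun f θ => ?_, fun f => ?_⟩
    · rw [hlr, hleft]
      refine OneForm.ext fun m v => ?_
      rw [OneForm.lmul_apply, OneForm.rmul_apply, hβ]
      refine (Commute.sum_left _ _ _ fun i _ => Commute.mul_left ?_ (hc m v _ _)).eq.symm
      rw [commute_iff_eq, ← hα, ← hα, SmoothMap.mul_comm_complex]
    · refine OneForm.ext fun m v => ?_
      have key := SmoothMap.sum_mul_derivation_eq_zero ((SmoothMap.eval m).comp α.toHom)
        (SmoothMap.derivAt m v ∘ₗ α.toHom.toAlgHom.toLinearMap)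
        (fun f g => (congrArg (SmoothMap.derivAt m v) (map_mul α.toHom f g)).trans
          (SmoothMap.derivAt_mul m v _ _))
        (fun f g => hc m v f g) Finset.univ
        (fun i : Option (Fin n) => i.elim (-1) fun i => OneForm.contract (X i) f.d)
        (fun i => i.elim f h) (fun m v => by
          rw [Fintype.sum_option]
          exact (congrArg (-1 * SmoothMap.derivAt m v f + ·) (hX m (f.d m) v)).trans
            ((congrArg (· + SmoothMap.derivAt m v f) (neg_one_mul _)).trans (neg_add_cancel _)))
      rw [Fintype.sum_option] at key
      change SmoothMap.eval m (α.toHom (-1)) * SmoothMap.derivAt m v (α f) +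
        ∑ i, α (OneForm.contract (X i) f.d) m * SmoothMap.derivAt m v (α (h i)) = 0 at key
      rw [map_neg, map_one, map_neg, map_one, ← hβ] at key
      rw [neg_one_mul, neg_add_eq_zero] at key
      exact key.symm
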